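/- Let $\mathbf k$ be a field of characteristic zero. A \emph{nonunital operad} is a sequence $\mathcal S=\{\mathcal S(n)\}_{n\ge 1}$ of $\mathbb Z$-graded $\mathbf k$-vector spaces with degree-preserving left $\mathbf k$-linear actions of the symmetric groups $\Sigma_n$, together with degree $0$ linear maps $\circ_i:\mathcal S(m)\otimes\mathcal S(n)\to\mathcal S(m+n-1)$, $1\le i\le n$ ($f\circ_i g$ is "$f$ plugged into the $i$-th input of $g$"), which satisfy, for $f\in\mathcal S(a)$, $g\in\mathcal S(b)$, $h\in\mathcal S(c)$ homogeneous, $$ f\circ_i(g\circ_j h)=\begin{cases}(-1)^{|f||g|}\,g\circ_{j+a-1}(f\circ_i h), & 1\le i\le j-1,\\ (f\circ_{i-j+1}g)\circ_j h, & j\le i\le j+b-1,\\ (-1)^{|f||g|}\,g\circ_j(f\circ_{i-b+1}h), & i\ge j+b,\end{cases} $$ and which are equivariant: $(\sigma f)\circ_{\tau(i)}(\tau g)=(\sigma\circ_i\tau)(f\circ_i g)$ for $\sigma\in\Sigma_m$, $\tau\in\Sigma_n$, where $\sigma\circ_i\tau\in\Sigma_{m+n-1}$ is obtained by inserting $\sigma$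 at the $i$-th place of $\tau$. A \emph{differential} on $\mathcal S$ is a family of $\Sigma_n$-equivariant linear maps $d:\mathcal S(n)\to\mathcal S(n)$ of degree $-1$ with $d^2=0$ and $d(f\circ_i g)=d(f)\circ_i g+(-1)^{|f|}f\circ_i d(g)$; then $(\mathcal S,d)$ is a \emph{dg operad}. Homomorphisms of (dg) operads are equivariant linear maps of degree $0$ commuting with all $\circ_i$ (and with the differentials). A \emph{collection} is a sequence $M=\{M(n)\}_{n\ge 2}$ of $\mathbb Z$-graded $\mathbf k$-vector spaces with degree-preserving $\mathbf k$-linear $\Sigma_n$-actions. $\mathcal F(M)$ denotes the free nonunital operad on $M$, $\mathcal F^l(M)\subset\mathcal F(M)$ the span of the elements obtained from $l$ elements of $M$ by the operations $\circ_i$ and the actions of the symmetric groups, and $\mathcal F^{\ge 2}(M)=\bigoplus_{l\ge 2}\mathcal F^l(M)$. **Theorem.** Let $(\mathcal S,d_{\mathcal S})$ be a dg operad over $\mathbf k$ with $\mathcal S(1)=0$. Then there exist a collection $M$, a differential $d$ on $\mathcal F(M)$ and a homomorphism of dg operads $\nu:(\mathcal F(M),d)\to(\mathcal S,d_{\mathcal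 S})$ such that 1. $d$ is minimal: $d(M)\subset\mathcal F^{\ge 2}(M)$; 2. $\nu$ induces an isomorphism in homology. Such a $\nu$ is called a minimal model of $(\mathcal S,d_{\mathcal S})$. It is unique in the following sense: if $\nu:(\mathcal F(M),d)\to(\mathcal S,d_{\mathcal S})$ and $\nu':(\mathcal F(M'),d')\to(\mathcal S,d_{\mathcal S})$ are two minimal models of $(\mathcal S,d_{\mathcal S})$, then the dg operads $(\mathcal F(M),d)$ and $(\mathcal F(M'),d')$ are isomorphic. -/

import Mathlib

universe u v w

/-- A sequence of `ℤ`-graded `k`-vector spaces with actions of the symmetric groups: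
`obj n p` is the degree `p` part of the `n`-th space, and `Σ_n` acts on it (from the left). -/
structure SymmSeq (k : Type u) [Field k] where
  obj : ℕ → ℤ → Type v
  [addCommGroup : ∀ n p, AddCommGroup (obj n p)]
  [module : ∀ n p, Module k (obj n p)]
  act : ∀ n p, Representation k (Equiv.Perm (Fin n)) (obj n p)

attribute [instance] SymmSeq.addCommGroup SymmSeq.module

/-- A collection `{E(n); n ≥ 2}` of graded vector spaces with `Σ_n`-actions; the sequence is
extended by `E(0) = E(1) = 0`. -/
structure OperadCollection (k : Type u) [Field k] extends SymmSeq.{u, v} k where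
  subsingleton_obj : ∀ n p, n < 2 → Subsingleton (obj n p)

namespace OperadPerm

/-- The position, among the `m + n - 1` inputs of `f ∘_i g`, of an input of `f` or of an input of
`g` other than the `i`-th (everything is numbered from `0`): the `m` inputs of `f` are inserted at
the `i`-th place. -/
def blockFun {m n r : ℕ} (h : m + n = r + 1) (i : Fin n) :
    Fin m ⊕ {j : Fin n // j ≠ i} → Fin r
  | Sum.inl a => ⟨i + a, by omega⟩
  | Sum.inr j => if hj : j.1 < i then ⟨j.1, by omega⟩ else
      ⟨j.1 + m - 1, by have := j.2; have := j.1.2; omega⟩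

theorem blockFun_bijective {m n r : ℕ} (h : m + n = r + 1) (i : Fin n) :
    Function.Bijective (blockFun h i) := by
  rw [Fintype.bijective_iff_injective_and_card]
  constructor
  · rintro (a | ⟨a, ha⟩) (b | ⟨b, hb⟩) hab
    · simp only [blockFun, Fin.mk.injEq] at hab
      congr 1; ext; omega
    · exfalso
      simp only [blockFun] at hab
      split_ifs at hab with h1 <;> simp only [Fin.mk.injEq] at hab <;> omega
    · exfalso
      simp only [blockFun] at hab
      split_ifs at hab with h1 <;> simp only [Fin.mk.injEq] at hab <;> omega
    · simp only [blockFun] at hab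
      congr 2; ext
      split_ifs at hab with h1 h2 h2 <;> simp only [Fin.mk.injEq] at hab <;> omega
  · have := i.2
    simp [Fintype.card_subtype_compl]
    omega

/-- `blockFun` as a bijection. -/
noncomputable def block {m n r : ℕ} (h : m + n = r + 1) (i : Fin n) :
    Fin m ⊕ {j : Fin n // j ≠ i} ≃ Fin r :=
  Equiv.ofBijective (blockFun h i) (blockFun_bijective h i)

/-- The permutation `σ ∘_i τ ∈ Σ_{m+n-1}` obtained by inserting `σ ∈ Σ_m` at the `i`-th place in
`τ ∈ Σ_n`: the block of `m` elements at place `i` is permuted by `σ` and is carried,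
as a whole, to place `τ i`, while the other elements are permuted by `τ`. -/
noncomputable def insertPerm {m n r : ℕ} (h : m + n = r + 1) (σ : Equiv.Perm (Fin m))
    (τ : Equiv.Perm (Fin n)) (i : Fin n) : Equiv.Perm (Fin r) :=
  (block h i).symm.trans <|
    (Equiv.sumCongr σ (τ.subtypeEquiv fun j => by simp)).trans (block h (τ i))

end OperadPerm

/-- A (graded, symmetric) nonunital operad `{S(n); n ≥ 1}`, extended by `S(0) = 0`.
For `f ∈ S(m)_p` and `g ∈ S(n)_q`, the element `comp hn hp i f g ∈ S(r)_s`, where `r = m + n - 1`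
and `s = p + q`, is `f ∘_i g`, that is, `f` is plugged into the `i`-th input of `g`.
Inputs are numbered from `0`, that is, `i : Fin n`.  In the left action of `Σ_n`, the `j`-th input
of `g` is the `τ j`-th input of `τ g`. -/
structure NonunitalOperad (k : Type u) [Field k] extends SymmSeq.{u, v} k where
  subsingleton_obj_zero : ∀ p, Subsingleton (obj 0 p)
  comp : ∀ {m n r : ℕ} {p q s : ℤ}, m + n = r + 1 → p + q = s → Fin n →
    (obj m p →ₗ[k] obj n q →ₗ[k] obj r s)
  /-- `f ∘_i (g ∘_j h) = (f ∘_{i-j} g) ∘_j h` if the `i`-th input of `g ∘_j h` belongs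
  to `g`. -/
  comp_assoc : ∀ {a b c ab bc abc : ℕ} {p q r pq qr pqr : ℤ}
    (hab : a + b = ab + 1) (hbc : b + c = bc + 1)
    (hl : ab + c = abc + 1) (hr : a + bc = abc + 1)
    (hpq : p + q = pq) (hqr : q + r = qr) (hl' : pq + r = pqr) (hr' : p + qr = pqr)
    (i : Fin bc) (j : Fin c) (i' : Fin b) (_ : (i : ℕ) = i' + j)
    (f : obj a p) (g : obj b q) (h : obj c r),
    comp hr hr' i f (comp hbc hqr j g h) = comp hl hl' j (comp hab hpq i' f g) h
  /-- `f ∘_i (g ∘_j h) = (-1)^{|f||g|} g ∘_{j+a-1} (f ∘_i h)` for `i < j`; read from right to left,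
  this is also the relation for an input `i ≥ j + b` of `g ∘_j h`. -/
  comp_comm : ∀ {a b c ac bc abc : ℕ} {p q r pr qr pqr : ℤ}
    (hac : a + c = ac + 1) (hbc : b + c = bc + 1)
    (hl : b + ac = abc + 1) (hr : a + bc = abc + 1)
    (hpr : p + r = pr) (hqr : q + r = qr) (hl' : q + pr = pqr) (hr' : p + qr = pqr)
    (i j : Fin c) (_ : i < j) (i' : Fin bc) (_ : (i' : ℕ) = i)
    (j' : Fin ac) (_ : (j' : ℕ) + 1 = j + a)
    (f : obj a p) (g : obj b q) (h : obj c r),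
    comp hr hr' i' f (comp hbc hqr j g h) =
      (-1 : k) ^ (p * q) • comp hl hl' j' g (comp hac hpr i f h)
  /-- Equivariance of the compositions. -/
  comp_act : ∀ {m n r : ℕ} {p q s : ℤ} (hn : m + n = r + 1) (hp : p + q = s)
    (σ : Equiv.Perm (Fin m)) (τ : Equiv.Perm (Fin n)) (i : Fin n) (f : obj m p) (g : obj n q),
    comp hn hp (τ i) (act m p σ f) (act n q τ g) =
      act r s (OperadPerm.insertPerm hn σ τ i) (comp hn hp i f g)

/-- A homomorphism of nonunital operads. -/
structure OperadHom {k : Type u} [Field k] (P : NonunitalOperad.{u, v} k)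
    (Q : NonunitalOperad.{u, w} k) where
  toFun : ∀ n p, P.obj n p →ₗ[k] Q.obj n p
  map_act : ∀ {n p} (σ : Equiv.Perm (Fin n)) (f : P.obj n p),
    toFun n p (P.act n p σ f) = Q.act n p σ (toFun n p f)
  map_comp : ∀ {m n r : ℕ} {p q s : ℤ} (hn : m + n = r + 1) (hp : p + q = s) (i : Fin n)
    (f : P.obj m p) (g : P.obj n q),
    toFun r s (P.comp hn hp i f g) = Q.comp hn hp i (toFun m p f) (toFun n q g)

/-- A differential on an operad: a derivation `d` of degree `-1` with `d² = 0`. -/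
structure OperadDifferential {k : Type u} [Field k] (P : NonunitalOperad.{u, v} k) where
  d : ∀ (n : ℕ) {p q : ℤ}, q + 1 = p → (P.obj n p →ₗ[k] P.obj n q)
  d_act : ∀ {n : ℕ} {p q : ℤ} (h : q + 1 = p) (σ : Equiv.Perm (Fin n)) (f : P.obj n p),
    d n h (P.act n p σ f) = P.act n q σ (d n h f)
  d_comp : ∀ {m n r : ℕ} {p q s p' q' s' : ℤ} (hn : m + n = r + 1) (hp : p + q = s)
    (hp' : p' + 1 = p) (hq' : q' + 1 = q) (hs' : s' + 1 = s)
    (h₁ : p' + q = s') (h₂ : p + q' = s') (i : Fin n) (f : P.obj m p) (g : P.obj n q),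
    d r hs' (P.comp hn hp i f g) =
      P.comp hn h₁ i (d m hp' f) g + (-1 : k) ^ p • P.comp hn h₂ i f (d n hq' g)
  d_d : ∀ {n : ℕ} {p q r : ℤ} (h : q + 1 = p) (h' : r + 1 = q) (f : P.obj n p),
    d n h' (d n h f) = 0

namespace OperadDifferential

variable {k : Type u} [Field k] {P : NonunitalOperad.{u, v} k} (D : OperadDifferential P)

/-- The degree `p` cycles in arity `n`. -/
def cycles (n : ℕ) (p : ℤ) : Submodule k (P.obj n p) :=
  LinearMap.ker (D.d n (sub_add_cancel p 1))

/-- The degree `p` boundaries in arity `n`. -/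
def boundaries (n : ℕ) (p : ℤ) : Submodule k (P.obj n p) :=
  LinearMap.range (D.d n (rfl : p + 1 = p + 1))

/-- The homology `H_p(P(n), d(n))`: cycles modulo boundaries. -/
abbrev homology (n : ℕ) (p : ℤ) : Type v :=
  D.cycles n p ⧸ (D.boundaries n p).submoduleOf (D.cycles n p)

end OperadDifferential

/-- A homomorphism `(P, D) → (Q, E)` of differential graded operads. -/
structure DGOperadHom {k : Type u} [Field k] {P : NonunitalOperad.{u, v} k}
    {Q : NonunitalOperad.{u, w} k} (D : OperadDifferential P) (E : OperadDifferential Q)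
    extends OperadHom P Q where
  map_d : ∀ {n : ℕ} {p q : ℤ} (h : q + 1 = p) (f : P.obj n p),
    toFun n q (D.d n h f) = E.d n h (toFun n p f)

namespace DGOperadHom

variable {k : Type u} [Field k] {P : NonunitalOperad.{u, v} k} {Q : NonunitalOperad.{u, w} k}
  {D : OperadDifferential P} {E : OperadDifferential Q} (φ : DGOperadHom D E)

/-- The map induced on cycles. -/
def cyclesMap (n : ℕ) (p : ℤ) : D.cycles n p →ₗ[k] E.cycles n p :=
  (φ.toFun n p).restrict fun x hx => by
    have hx' : D.d n (sub_add_cancel p 1) x = 0 := hx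
    change E.d n (sub_add_cancel p 1) (φ.toFun n p x) = 0
    rw [← φ.map_d, hx', map_zero]

/-- The map induced in homology. -/
def homologyMap (n : ℕ) (p : ℤ) : D.homology n p →ₗ[k] E.homology n p :=
  Submodule.mapQ _ _ (φ.cyclesMap n p) (by
    rintro ⟨x, hx⟩ ⟨y, hy⟩
    exact ⟨φ.toFun n (p + 1) y, by
      rw [← φ.map_d]
      exact congrArg (φ.toFun n p) hy⟩)

/-- The homomorphism induces an isomorphism in homology. -/
def IsHomologyIso : Prop :=
  ∀ n p, Function.Bijective (φ.homologyMap n p)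

end DGOperadHom

/-- An isomorphism of differential graded operads: a pair of mutually inverse homomorphisms. -/
structure DGOperadIso {k : Type u} [Field k] {P : NonunitalOperad.{u, v} k}
    {Q : NonunitalOperad.{u, w} k} (D : OperadDifferential P) (E : OperadDifferential Q) where
  hom : DGOperadHom D E
  inv : DGOperadHom E D
  hom_inv : ∀ n p (f : P.obj n p), inv.toFun n p (hom.toFun n p f) = f
  inv_hom : ∀ n p (g : Q.obj n p), hom.toFun n p (inv.toFun n p g) = g

/-! The free nonunital operad `F(M)` on a collection `M`: formal expressions in the elements of
`M`, modulo the congruence generated by the axioms of a nonunital operad and by the requirement that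
`M → F(M)` be a map of collections. -/

namespace FreeOperad

/-- Formal expressions of given arity and degree. -/
inductive Term {k : Type u} [Field k] (M : OperadCollection.{u, v} k) :
    ℕ → ℤ → Type (max u v)
  | gen {n p} (x : M.obj n p) : Term M n p
  | zero {n p} : Term M n p
  | add {n p} (s t : Term M n p) : Term M n p
  | smul {n p} (c : k) (t : Term M n p) : Term M n p
  | act {n p} (σ : Equiv.Perm (Fin n)) (t : Term M n p) : Term M n p
  | comp {m n r p q s} (hn : m + n = r + 1) (hp : p + q = s) (i : Fin n)
      (f : Term M m p) (g : Term M n q) : Term M r s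

open Term in
/-- The congruence generated by the axioms. -/
inductive Rel {k : Type u} [Field k] (M : OperadCollection.{u, v} k) :
    ∀ {n : ℕ} {p : ℤ}, Term M n p → Term M n p → Prop
  -- equivalence relation
  | refl {n p} (t : Term M n p) : Rel M t t
  | symm {n p} {s t : Term M n p} : Rel M s t → Rel M t s
  | trans {n p} {s t r : Term M n p} : Rel M s t → Rel M t r → Rel M s r
  -- compatibility with the operations
  | add {n p} {s s' t t' : Term M n p} : Rel M s s' → Rel M t t' → Rel M (add s t) (add s' t')
  | smul {n p} (c : k) {t t' : Term M n p} : Rel M t t' → Rel M (smul c t) (smul c t')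
  | act {n p} (σ : Equiv.Perm (Fin n)) {t t' : Term M n p} :
      Rel M t t' → Rel M (act σ t) (act σ t')
  | comp {m n r p q s} (hn : m + n = r + 1) (hp : p + q = s) (i : Fin n)
      {f f' : Term M m p} {g g' : Term M n q} :
      Rel M f f' → Rel M g g' → Rel M (comp hn hp i f g) (comp hn hp i f' g')
  -- vector spaces
  | add_comm {n p} (s t : Term M n p) : Rel M (add s t) (add t s)
  | add_assoc {n p} (s t r : Term M n p) : Rel M (add (add s t) r) (add s (add t r))
  | zero_add {n p} (t : Term M n p) : Rel M (add zero t) t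
  | neg_add {n p} (t : Term M n p) : Rel M (add (smul (-1) t) t) zero
  | smul_add {n p} (c : k) (s t : Term M n p) :
      Rel M (smul c (add s t)) (add (smul c s) (smul c t))
  | add_smul {n p} (c e : k) (t : Term M n p) :
      Rel M (smul (c + e) t) (add (smul c t) (smul e t))
  | mul_smul {n p} (c e : k) (t : Term M n p) : Rel M (smul (c * e) t) (smul c (smul e t))
  | one_smul {n p} (t : Term M n p) : Rel M (smul 1 t) t
  -- linear actions of the symmetric groups
  | act_one {n p} (t : Term M n p) : Rel M (act 1 t) t
  | act_mul {n p} (σ τ : Equiv.Perm (Fin n)) (t : Term M n p) :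
      Rel M (act (σ * τ) t) (act σ (act τ t))
  | act_add {n p} (σ : Equiv.Perm (Fin n)) (s t : Term M n p) :
      Rel M (act σ (add s t)) (add (act σ s) (act σ t))
  | act_smul {n p} (σ : Equiv.Perm (Fin n)) (c : k) (t : Term M n p) :
      Rel M (act σ (smul c t)) (smul c (act σ t))
  -- `M → F(M)` is linear and equivariant
  | gen_add {n p} (x y : M.obj n p) : Rel M (gen (x + y)) (add (gen x) (gen y))
  | gen_smul {n p} (c : k) (x : M.obj n p) : Rel M (gen (c • x)) (smul c (gen x))
  | gen_act {n p} (σ : Equiv.Perm (Fin n)) (x : M.obj n p) :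
      Rel M (gen (M.act n p σ x)) (act σ (gen x))
  -- bilinearity of the compositions
  | comp_add_left {m n r p q s} (hn : m + n = r + 1) (hp : p + q = s) (i : Fin n)
      (f f' : Term M m p) (g : Term M n q) :
      Rel M (comp hn hp i (add f f') g) (add (comp hn hp i f g) (comp hn hp i f' g))
  | comp_smul_left {m n r p q s} (hn : m + n = r + 1) (hp : p + q = s) (i : Fin n)
      (c : k) (f : Term M m p) (g : Term M n q) :
      Rel M (comp hn hp i (smul c f) g) (smul c (comp hn hp i f g))
  | comp_add_right {m n r p q s} (hn : m + n = r + 1) (hp : p + q = s) (i : Fin n)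
      (f : Term M m p) (g g' : Term M n q) :
      Rel M (comp hn hp i f (add g g')) (add (comp hn hp i f g) (comp hn hp i f g'))
  | comp_smul_right {m n r p q s} (hn : m + n = r + 1) (hp : p + q = s) (i : Fin n)
      (c : k) (f : Term M m p) (g : Term M n q) :
      Rel M (comp hn hp i f (smul c g)) (smul c (comp hn hp i f g))
  -- the axioms of a nonunital operad
  | comp_assoc {a b c ab bc abc : ℕ} {p q r pq qr pqr : ℤ}
      (hab : a + b = ab + 1) (hbc : b + c = bc + 1)
      (hl : ab + c = abc + 1) (hr : a + bc = abc + 1)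
      (hpq : p + q = pq) (hqr : q + r = qr) (hl' : pq + r = pqr) (hr' : p + qr = pqr)
      (i : Fin bc) (j : Fin c) (i' : Fin b) (_ : (i : ℕ) = i' + j)
      (f : Term M a p) (g : Term M b q) (h : Term M c r) :
      Rel M (comp hr hr' i f (comp hbc hqr j g h)) (comp hl hl' j (comp hab hpq i' f g) h)
  | comp_comm {a b c ac bc abc : ℕ} {p q r pr qr pqr : ℤ}
      (hac : a + c = ac + 1) (hbc : b + c = bc + 1)
      (hl : b + ac = abc + 1) (hr : a + bc = abc + 1)
      (hpr : p + r = pr) (hqr : q + r = qr) (hl' : q + pr = pqr) (hr' : p + qr = pqr)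
      (i j : Fin c) (_ : i < j) (i' : Fin bc) (_ : (i' : ℕ) = i)
      (j' : Fin ac) (_ : (j' : ℕ) + 1 = j + a)
      (f : Term M a p) (g : Term M b q) (h : Term M c r) :
      Rel M (comp hr hr' i' f (comp hbc hqr j g h))
        (smul ((-1 : k) ^ (p * q)) (comp hl hl' j' g (comp hac hpr i f h)))
  | comp_act {m n r p q s} (hn : m + n = r + 1) (hp : p + q = s)
      (σ : Equiv.Perm (Fin m)) (τ : Equiv.Perm (Fin n)) (i : Fin n)
      (f : Term M m p) (g : Term M n q) :
      Rel M (comp hn hp (τ i) (act σ f) (act τ g))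
        (act (OperadPerm.insertPerm hn σ τ i) (comp hn hp i f g))

variable {k : Type u} [Field k] (M : OperadCollection.{u, v} k)

/-- The congruence as a setoid. -/
def relSetoid (n : ℕ) (p : ℤ) : Setoid (Term M n p) where
  r := Rel M
  iseqv := ⟨Rel.refl, Rel.symm, Rel.trans⟩

/-- The space `F(M)(n)_p`. -/
def Obj (n : ℕ) (p : ℤ) : Type (max u v) := Quotient (relSetoid M n p)

variable {M}

/-- The class of an expression. -/
def mk {n : ℕ} {p : ℤ} (t : Term M n p) : Obj M n p := Quotient.mk (relSetoid M n p) t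

theorem mk_eq {n : ℕ} {p : ℤ} {s t : Term M n p} (h : Rel M s t) : mk s = mk t :=
  Quotient.sound h

theorem mk_surjective {n : ℕ} {p : ℤ} (x : Obj M n p) : ∃ t, mk t = x := Quotient.exists_rep x

instance (n : ℕ) (p : ℤ) : Zero (Obj M n p) := ⟨mk .zero⟩

instance (n : ℕ) (p : ℤ) : Add (Obj M n p) :=
  ⟨Quotient.map₂ .add fun _ _ h _ _ h' => Rel.add h h'⟩

instance (n : ℕ) (p : ℤ) : SMul k (Obj M n p) :=
  ⟨fun c => Quotient.map (.smul c) fun _ _ h => Rel.smul c h⟩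

instance (n : ℕ) (p : ℤ) : Neg (Obj M n p) := ⟨fun x => (-1 : k) • x⟩

instance (n : ℕ) (p : ℤ) : AddCommGroup (Obj M n p) :=
  have hcomm : ∀ x y : Obj M n p, x + y = y + x := by
    rintro ⟨x⟩ ⟨y⟩; exact mk_eq (Rel.add_comm x y)
  have hzero : ∀ x : Obj M n p, 0 + x = x := by
    rintro ⟨x⟩; exact mk_eq (Rel.zero_add x)
  { add_assoc := by rintro ⟨x⟩ ⟨y⟩ ⟨z⟩; exact mk_eq (Rel.add_assoc x y z)
    zero_add := hzero
    add_zero := fun x => (hcomm x 0).trans (hzero x)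
    add_comm := hcomm
    neg_add_cancel := by rintro ⟨x⟩; exact mk_eq (Rel.neg_add x)
    nsmul := nsmulRec
    zsmul := zsmulRec }

instance (n : ℕ) (p : ℤ) : Module k (Obj M n p) :=
  Module.ofMinimalAxioms
    (by rintro c ⟨x⟩ ⟨y⟩; exact mk_eq (Rel.smul_add c x y))
    (by rintro c e ⟨x⟩; exact mk_eq (Rel.add_smul c e x))
    (by rintro c e ⟨x⟩; exact mk_eq (Rel.mul_smul c e x))
    (by rintro ⟨x⟩; exact mk_eq (Rel.one_smul x))

variable (M)

/-- The map of collections `M → F(M)`. -/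
def ι (n : ℕ) (p : ℤ) : M.obj n p →ₗ[k] Obj M n p where
  toFun x := mk (.gen x)
  map_add' x y := mk_eq (Rel.gen_add x y)
  map_smul' c x := mk_eq (Rel.gen_smul c x)

/-- The action of `Σ_n` on `F(M)(n)_p`. -/
def act (n : ℕ) (p : ℤ) : Representation k (Equiv.Perm (Fin n)) (Obj M n p) where
  toFun σ :=
    { toFun := Quotient.map (.act σ) fun _ _ h => Rel.act σ h
      map_add' := by rintro ⟨x⟩ ⟨y⟩; exact mk_eq (Rel.act_add σ x y)
      map_smul' := by rintro c ⟨x⟩; exact mk_eq (Rel.act_smul σ c x) }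
  map_one' := by ext ⟨x⟩; exact mk_eq (Rel.act_one x)
  map_mul' σ τ := by ext ⟨x⟩; exact mk_eq (Rel.act_mul σ τ x)

/-- The compositions `∘_i` of `F(M)`. -/
def comp {m n r : ℕ} {p q s : ℤ} (hn : m + n = r + 1) (hp : p + q = s) (i : Fin n) :
    Obj M m p →ₗ[k] Obj M n q →ₗ[k] Obj M r s :=
  LinearMap.mk₂ k (Quotient.map₂ (.comp hn hp i) fun _ _ h _ _ h' => Rel.comp hn hp i h h')
    (by rintro ⟨x⟩ ⟨y⟩ ⟨z⟩; exact mk_eq (Rel.comp_add_left hn hp i x y z))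
    (by rintro c ⟨x⟩ ⟨y⟩; exact mk_eq (Rel.comp_smul_left hn hp i c x y))
    (by rintro ⟨x⟩ ⟨y⟩ ⟨z⟩; exact mk_eq (Rel.comp_add_right hn hp i x y z))
    (by rintro c ⟨x⟩ ⟨y⟩; exact mk_eq (Rel.comp_smul_right hn hp i c x y))

theorem mk_eq_zero {n : ℕ} {p : ℤ} (t : Term M n p) (hn : n = 0) : mk t = 0 := by
  induction t with
  | @gen n p x =>
    have := M.subsingleton_obj n p (by omega)
    rw [Subsingleton.elim x 0]
    exact map_zero (ι M n p)
  | zero => rfl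
  | add s t hs ht =>
    change mk s + mk t = 0
    rw [hs hn, ht hn, add_zero]
  | smul c t ht =>
    change c • mk t = 0
    rw [ht hn, smul_zero]
  | act σ t ht =>
    change act M _ _ σ (mk t) = 0
    rw [ht hn, map_zero]
  | comp h hp i f g hf hg =>
    change comp M h hp i (mk f) (mk g) = 0
    rw [hf (by have := i.2; omega), map_zero, LinearMap.zero_apply]

end FreeOperad

/-- The free nonunital operad `F(M)` on a collection `M`. -/
def freeOperad {k : Type u} [Field k] (M : OperadCollection.{u, v} k) :
    NonunitalOperad.{u, max u v} k where
  obj := FreeOperad.Obj M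
  act := FreeOperad.act M
  subsingleton_obj_zero p := subsingleton_of_forall_eq 0 (by
    rintro ⟨t⟩; exact FreeOperad.mk_eq_zero M t rfl)
  comp := FreeOperad.comp M
  comp_assoc hab hbc hl hr hpq hqr hl' hr' i j i' hi := by
    rintro ⟨f⟩ ⟨g⟩ ⟨h⟩
    exact FreeOperad.mk_eq
      (FreeOperad.Rel.comp_assoc hab hbc hl hr hpq hqr hl' hr' i j i' hi f g h)
  comp_comm hac hbc hl hr hpr hqr hl' hr' i j hij i' hi' j' hj' := by
    rintro ⟨f⟩ ⟨g⟩ ⟨h⟩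
    exact FreeOperad.mk_eq
      (FreeOperad.Rel.comp_comm hac hbc hl hr hpr hqr hl' hr' i j hij i' hi' j' hj' f g h)
  comp_act hn hp σ τ i := by
    rintro ⟨f⟩ ⟨g⟩
    exact FreeOperad.mk_eq (FreeOperad.Rel.comp_act hn hp σ τ i f g)

namespace FreeOperad

variable {k : Type u} [Field k] {M : OperadCollection.{u, v} k}

/-- `x` is a word of length `l`: it is obtained from `l` elements of `M` by the compositions `∘_i`
and the actions of the symmetric groups (it corresponds to a tree with `l` vertices, that is, with
`l - 1` inner edges). -/
inductive IsWord : ℕ → ∀ {n : ℕ} {p : ℤ}, (freeOperad M).obj n p → Prop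
  | gen {n p} (x : M.obj n p) : IsWord 1 (ι M n p x)
  | act {l n p} (σ : Equiv.Perm (Fin n)) {x : (freeOperad M).obj n p} :
      IsWord l x → IsWord l ((freeOperad M).act n p σ x)
  | comp {l l' m n r p q s} (hn : m + n = r + 1) (hp : p + q = s) (i : Fin n)
      {x : (freeOperad M).obj m p} {y : (freeOperad M).obj n q} :
      IsWord l x → IsWord l' y → IsWord (l + l') ((freeOperad M).comp hn hp i x y)

variable (M)

/-- The part `F^l(M)(n)_p` spanned by the words of length `l`. -/
def lengthPart (l n : ℕ) (p : ℤ) : Submodule k ((freeOperad M).obj n p) :=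
  Submodule.span k {x | IsWord l x}

/-- `F^{≥ l}(M)(n)_p`, the sum of the `F^j(M)(n)_p` with `j ≥ l`. -/
def lengthGE (l n : ℕ) (p : ℤ) : Submodule k ((freeOperad M).obj n p) :=
  ⨆ j ≥ l, lengthPart M j n p

variable {M}

/-- A differential `d` on `F(M)` is minimal if `d(M) ⊆ F^{≥ 2}(M)`. -/
def IsMinimal (D : OperadDifferential (freeOperad M)) : Prop :=
  ∀ (n : ℕ) (p q : ℤ) (h : q + 1 = p) (x : M.obj n p),
    D.d n h (ι M n p x) ∈ lengthGE M 2 n q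

end FreeOperad

/-!
*Existence.* The model is built arity by arity. Given `M` concentrated in arities at most `N + 1`
and `ν : F(M) → S` which is a homology isomorphism in these arities, the generators added in arity
`N + 2` represent the homology of the mapping cone of `ν` in that arity; Maschke's theorem allows
choosing them equivariantly, as a complement of the boundaries among the cycles. Every element of
`F(M)` of arity `N + 2` is decomposable, so the differential stays minimal. In the limit each arity
is affected only finitely often.

*Uniqueness.* Let `W` be the cone of `S`, truncated to arities at least `2`. Then `ν'` extends to a
homomorphism `F(M' ⊕ W) → S` which is surjective in these arities. The inclusion `F(M') → F(M' ⊕ W)`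
is a homology isomorphism: the contraction of `W` extends to a derivation `s` which is zero on `M'`,
and the derivation `d s + s d` multiplies a composition of generators by the number of its factors
from `W`; in characteristic zero it is therefore invertible on the kernel of the retraction
`F(M' ⊕ W) → F(M')`. A minimal free operad lifts through surjective homology isomorphisms, by
induction on the arity, so there is a homology isomorphism `F(M) → F(M' ⊕ W) → F(M')`. A homology
isomorphism between minimal free operads is bijective, again by induction on the arity.
-/

universe v₁ v₂ v₃

/-! ### Equivariant maps and derivations -/

namespace SymmSeq

/-- Transport of elements along an equality of degrees. -/
def degreeCast {k : Type u} [Field k] (A : SymmSeq.{u, v} k) {n : ℕ} {p q : ℤ} (h : p = q) :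
    A.obj n p →ₗ[k] A.obj n q :=
  h ▸ LinearMap.id

end SymmSeq

/-- Morphisms of symmetric sequences of graded vector spaces: equivariant maps of degree `0`. -/
structure SymmSeqHom {k : Type u} [Field k] (A : SymmSeq.{u, v₁} k) (B : SymmSeq.{u, v₂} k) where
  toFun : ∀ {n p}, A.obj n p →ₗ[k] B.obj n p
  map_act : ∀ {n p} (σ : Equiv.Perm (Fin n)) (x : A.obj n p),
    toFun (A.act n p σ x) = B.act n p σ (toFun x)

/-- Equivariant maps of degree `-e` between symmetric sequences of graded vector spaces. As for
`OperadDifferential`, the degrees of source and target are related by an equation. -/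
structure SymmSeqShiftHom {k : Type u} [Field k] (A : SymmSeq.{u, v₁} k) (B : SymmSeq.{u, v₂} k)
    (e : ℤ) where
  toFun : ∀ {n : ℕ} {p q : ℤ}, q + e = p → (A.obj n p →ₗ[k] B.obj n q)
  map_act : ∀ {n : ℕ} {p q : ℤ} (h : q + e = p) (σ : Equiv.Perm (Fin n)) (x : A.obj n p),
    toFun h (A.act n p σ x) = B.act n q σ (toFun h x)

/-- Derivations of degree `-e` of an operad. -/
structure OperadDerivation {k : Type u} [Field k] (P : NonunitalOperad.{u, v} k) (e : ℤ) extends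
    SymmSeqShiftHom P.toSymmSeq P.toSymmSeq e where
  map_comp : ∀ {m n r : ℕ} {p q s p' q' s' : ℤ} (hn : m + n = r + 1) (hp : p + q = s)
    (hp' : p' + e = p) (hq' : q' + e = q) (hs' : s' + e = s)
    (h₁ : p' + q = s') (h₂ : p + q' = s') (i : Fin n) (f : P.obj m p) (g : P.obj n q),
    toFun hs' (P.comp hn hp i f g) =
      P.comp hn h₁ i (toFun hp' f) g + (-1 : k) ^ (e * p) • P.comp hn h₂ i f (toFun hq' g)

section Coercions

variable {k : Type u} [Field k]

/-- `OperadHom.toFun` with implicit arity and degree, for use as a coercion. -/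
abbrev OperadHom.app {P : NonunitalOperad.{u, v₁} k} {Q : NonunitalOperad.{u, v₂} k}
    (φ : OperadHom P Q) {n : ℕ} {p : ℤ} : P.obj n p →ₗ[k] Q.obj n p := φ.toFun n p

instance {A : SymmSeq.{u, v₁} k} {B : SymmSeq.{u, v₂} k} :
    CoeFun (SymmSeqHom A B) fun _ => ∀ {n p}, A.obj n p →ₗ[k] B.obj n p :=
  ⟨@SymmSeqHom.toFun _ _ _ _⟩

instance {A : SymmSeq.{u, v₁} k} {B : SymmSeq.{u, v₂} k} {e : ℤ} :
    CoeFun (SymmSeqShiftHom A B e) fun _ => ∀ {n p q}, q + e = p → (A.obj n p →ₗ[k] B.obj n q) :=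
  ⟨@SymmSeqShiftHom.toFun _ _ _ _ _⟩

instance {P : NonunitalOperad.{u, v} k} {e : ℤ} :
    CoeFun (OperadDerivation P e) fun _ => ∀ {n p q}, q + e = p → (P.obj n p →ₗ[k] P.obj n q) :=
  ⟨fun Δ => @SymmSeqShiftHom.toFun _ _ _ _ _ Δ.toSymmSeqShiftHom⟩

instance {P : NonunitalOperad.{u, v₁} k} {Q : NonunitalOperad.{u, v₂} k} :
    CoeFun (OperadHom P Q) fun _ => ∀ {n p}, P.obj n p →ₗ[k] Q.obj n p :=
  ⟨@OperadHom.app _ _ _ _⟩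

instance {P : NonunitalOperad.{u, v₁} k} {Q : NonunitalOperad.{u, v₂} k} {D : OperadDifferential P}
    {E : OperadDifferential Q} :
    CoeFun (DGOperadHom D E) fun _ => ∀ {n p}, P.obj n p →ₗ[k] Q.obj n p :=
  ⟨fun φ => @OperadHom.app _ _ _ _ φ.toOperadHom⟩

end Coercions

namespace SymmSeqHom

variable {k : Type u} [Field k] {A : SymmSeq.{u, v₁} k} {B : SymmSeq.{u, v₂} k}
  {C : SymmSeq.{u, v₃} k}

/-- Composition of morphisms. -/
def comp (g : SymmSeqHom B C) (f : SymmSeqHom A B) : SymmSeqHom A C where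
  toFun := g.toFun ∘ₗ f.toFun
  map_act σ x := by simp [f.map_act, g.map_act]

@[simp]
theorem comp_apply (g : SymmSeqHom B C) (f : SymmSeqHom A B) {n : ℕ} {p : ℤ} (x : A.obj n p) :
    g.comp f x = g (f x) := rfl

instance : Zero (SymmSeqHom A B) := ⟨⟨0, by simp⟩⟩

@[simp]
theorem zero_apply {n : ℕ} {p : ℤ} (x : A.obj n p) : (0 : SymmSeqHom A B) x = 0 := rfl

/-- Composition of a morphism with an equivariant map of some degree. -/
def compShiftHom {e : ℤ} (g : SymmSeqHom B C) (f : SymmSeqShiftHom A B e) :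
    SymmSeqShiftHom A C e where
  toFun h := g.toFun ∘ₗ f.toFun h
  map_act h σ x := by simp [f.map_act, g.map_act]

@[simp]
theorem compShiftHom_apply {e : ℤ} (g : SymmSeqHom B C) (f : SymmSeqShiftHom A B e) {n : ℕ}
    {p q : ℤ} (h : q + e = p) (x : A.obj n p) : g.compShiftHom f h x = g (f h x) := rfl

end SymmSeqHom

namespace SymmSeqShiftHom

variable {k : Type u} [Field k] {A : SymmSeq.{u, v₁} k} {B : SymmSeq.{u, v₂} k}
  {C : SymmSeq.{u, v₃} k} {e e' : ℤ}

instance : Zero (SymmSeqShiftHom A B e) := ⟨⟨fun _ => 0, by simp⟩⟩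

@[simp]
theorem zero_apply {n : ℕ} {p q : ℤ} (h : q + e = p) (x : A.obj n p) :
    (0 : SymmSeqShiftHom A B e) h x = 0 := rfl

/-- Composition of equivariant maps. -/
def comp (g : SymmSeqShiftHom B C e) (f : SymmSeqShiftHom A B e') :
    SymmSeqShiftHom A C (e + e') where
  toFun {_ p _} h := g (by omega) ∘ₗ f (sub_add_cancel p e')
  map_act h σ x := by simp [f.map_act, g.map_act]

theorem comp_apply (g : SymmSeqShiftHom B C e) (f : SymmSeqShiftHom A B e') {n : ℕ} {p q r : ℤ}
    (h : q + e' = p) (h' : r + e = q) (h'' : r + (e + e') = p) (x : A.obj n p) :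
    g.comp f h'' x = g h' (f h x) := by
  obtain rfl : q = p - e' := by omega
  rfl

end SymmSeqShiftHom

namespace OperadHom

variable {k : Type u} [Field k] {P : NonunitalOperad.{u, v₁} k} {Q : NonunitalOperad.{u, v₂} k}
  {R : NonunitalOperad.{u, v₃} k}

/-- The underlying morphism of symmetric sequences. -/
def toSymmSeqHom (φ : OperadHom P Q) : SymmSeqHom P.toSymmSeq Q.toSymmSeq where
  toFun := φ.app
  map_act := φ.map_act

@[simp]
theorem toSymmSeqHom_apply (φ : OperadHom P Q) {n : ℕ} {p : ℤ} (x : P.obj n p) :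
    φ.toSymmSeqHom x = φ x := rfl

/-- Composition of homomorphisms. -/
def comp (ψ : OperadHom Q R) (φ : OperadHom P Q) : OperadHom P R where
  toFun _ _ := ψ.app ∘ₗ φ.app
  map_act σ x := by simp [φ.map_act, ψ.map_act]
  map_comp hn hp i f g := by simp [φ.map_comp, ψ.map_comp]

@[simp]
theorem comp_apply (ψ : OperadHom Q R) (φ : OperadHom P Q) {n : ℕ} {p : ℤ} (x : P.obj n p) :
    ψ.comp φ x = ψ (φ x) := rfl

variable (P) in
/-- The identity homomorphism. -/
def id : OperadHom P P where
  toFun _ _ := LinearMap.id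
  map_act _ _ := rfl
  map_comp _ _ _ _ _ := rfl

@[simp]
theorem id_apply {n : ℕ} {p : ℤ} (x : P.obj n p) : id P x = x := rfl

end OperadHom

namespace OperadDifferential

variable {k : Type u} [Field k] {P : NonunitalOperad.{u, v} k}

/-- The underlying derivation of a differential. -/
def toDerivation (D : OperadDifferential P) : OperadDerivation P 1 where
  toFun := D.d _
  map_act := D.d_act
  map_comp hn hp hp' hq' hs' h₁ h₂ i f g := by
    rw [one_mul, D.d_comp hn hp hp' hq' hs' h₁ h₂]

@[simp]
theorem toDerivation_apply (D : OperadDifferential P) {n : ℕ} {p q : ℤ} (h : q + 1 = p)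
    (x : P.obj n p) : D.toDerivation h x = D.d n h x := rfl

end OperadDifferential

theorem neg_one_zpow_eq_of_even_sub {k : Type u} [Field k] {a b : ℤ} (h : Even (a - b)) :
    (-1 : k) ^ a = (-1 : k) ^ b := by
  rw [← sub_add_cancel a b, zpow_add₀ (neg_ne_zero.2 one_ne_zero), h.neg_one_zpow, one_mul]

theorem neg_one_zpow_eq_neg_of_odd_sub {k : Type u} [Field k] {a b : ℤ} (h : Odd (a - b)) :
    (-1 : k) ^ a = -(-1 : k) ^ b := by
  rw [← sub_add_cancel a b, zpow_add₀ (neg_ne_zero.2 one_ne_zero), h.neg_one_zpow, neg_one_mul]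

namespace OperadDerivation

variable {k : Type u} [Field k] {P : NonunitalOperad.{u, v₁} k} {e e' : ℤ}

instance : Zero (OperadDerivation P e) := ⟨⟨0, by intros; simp⟩⟩

@[simp]
theorem zero_apply {n : ℕ} {p q : ℤ} (h : q + e = p) (x : P.obj n p) :
    (0 : OperadDerivation P e) h x = 0 := rfl

theorem map_map_comp (Δ : OperadDerivation P e) (Δ' : OperadDerivation P e') {m n r : ℕ}
    {p q s p' q' s' : ℤ} (hn : m + n = r + 1) (hp : p + q = s) (hp' : p' + (e + e') = p)
    (hq' : q' + (e + e') = q) (hs' : s' + (e + e') = s) (i : Fin n) (f : P.obj m p)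
    (g : P.obj n q) :
    Δ.toSymmSeqShiftHom.comp Δ'.toSymmSeqShiftHom hs' (P.comp hn hp i f g) =
      P.comp hn (by omega) i (Δ.toSymmSeqShiftHom.comp Δ'.toSymmSeqShiftHom hp' f) g +
        (-1 : k) ^ (e * (p - e')) •
          P.comp hn (by omega) i (Δ' (sub_add_cancel p e') f) (Δ (sub_add_cancel q e) g) +
        ((-1 : k) ^ (e' * p) •
            P.comp hn (by omega) i (Δ (sub_add_cancel p e) f) (Δ' (sub_add_cancel q e') g) +
          (-1 : k) ^ ((e + e') * p) •
            P.comp hn (by omega) i f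
              (Δ.toSymmSeqShiftHom.comp Δ'.toSymmSeqShiftHom hq' g)) := by
  rw [SymmSeqShiftHom.comp_apply _ _ (sub_add_cancel s e') (by omega),
    SymmSeqShiftHom.comp_apply _ _ (sub_add_cancel p e') (by omega),
    SymmSeqShiftHom.comp_apply _ _ (sub_add_cancel q e') (by omega),
    Δ'.map_comp hn hp (sub_add_cancel p e') (sub_add_cancel q e') _ (by omega) (by omega),
    map_add, map_smul,
    Δ.map_comp hn _ (by omega : p' + e = _) (sub_add_cancel q e) _ (by omega) (by omega),
    Δ.map_comp hn _ (sub_add_cancel p e) (by omega : q' + e = _) _ (by omega) (by omega),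
    smul_add, smul_smul, ← zpow_add₀ (neg_ne_zero.2 one_ne_zero),
    show e' * p + e * p = (e + e') * p by ring]

/-- The graded commutator `ΔΔ' + Δ'Δ` of two derivations of odd degrees. -/
def anticommutator (Δ : OperadDerivation P e) (Δ' : OperadDerivation P e') (he : Odd e)
    (he' : Odd e') : OperadDerivation P (e + e') where
  toFun h := Δ.toSymmSeqShiftHom.comp Δ'.toSymmSeqShiftHom h +
    Δ'.toSymmSeqShiftHom.comp Δ.toSymmSeqShiftHom (by omega)
  map_act h σ x := by simp [SymmSeqShiftHom.map_act]
  map_comp {m n r p q s p' q' s'} hn hp hp' hq' hs' h₁ h₂ i f g := by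
    have hsign : (-1 : k) ^ (e * (p - e')) = -(-1) ^ (e * p) :=
      neg_one_zpow_eq_neg_of_odd_sub (by
        rw [show e * (p - e') - e * p = -(e * e') by ring]; exact (he.mul he').neg)
    have hsign' : (-1 : k) ^ (e' * (p - e)) = -(-1) ^ (e' * p) :=
      neg_one_zpow_eq_neg_of_odd_sub (by
        rw [show e' * (p - e) - e' * p = -(e * e') by ring]; exact (he.mul he').neg)
    simp only [LinearMap.add_apply, map_add, smul_add]
    rw [map_map_comp Δ Δ' hn hp hp' hq' hs',
      map_map_comp Δ' Δ hn hp (by omega : p' + (e' + e) = p) (by omega : q' + (e' + e) = q)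
        (by omega), hsign, hsign', show (e' + e) * p = (e + e') * p by ring]
    simp only [neg_smul]
    abel

theorem anticommutator_apply (Δ : OperadDerivation P e) (Δ' : OperadDerivation P e') (he : Odd e)
    (he' : Odd e') {n : ℕ} {p q r s : ℤ} (h : r + (e + e') = p) (hq : q + e' = p) (hq' : r + e = q)
    (hs : s + e = p) (hs' : r + e' = s) (x : P.obj n p) :
    Δ.anticommutator Δ' he he' h x = Δ hq' (Δ' hq x) + Δ' hs' (Δ hs x) := by
  rw [← SymmSeqShiftHom.comp_apply, ← SymmSeqShiftHom.comp_apply]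
  rfl

/-- The elements killed by the square of `Δ`. -/
def squareZeroLocus (Δ : OperadDerivation P e) (n : ℕ) (p : ℤ) : Submodule k (P.obj n p) :=
  ⨅ (q : ℤ) (h : q + (e + e) = p),
    LinearMap.ker (Δ.toSymmSeqShiftHom.comp Δ.toSymmSeqShiftHom h)

theorem mem_squareZeroLocus {Δ : OperadDerivation P e} {n : ℕ} {p : ℤ} {x : P.obj n p} :
    x ∈ Δ.squareZeroLocus n p ↔ ∀ (q : ℤ) (h : q + (e + e) = p),
      Δ.toSymmSeqShiftHom.comp Δ.toSymmSeqShiftHom h x = 0 := by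
  simp [squareZeroLocus]

end OperadDerivation

namespace NonunitalOperad

variable {k : Type u} [Field k] (P : NonunitalOperad.{u, v₁} k) {Q : NonunitalOperad.{u, v₂} k}

/-- A family of subspaces which is stable under the operations of the operad. -/
structure IsSuboperad (C : ∀ n p, Submodule k (P.obj n p)) : Prop where
  act_mem : ∀ {n p} (σ : Equiv.Perm (Fin n)) {x : P.obj n p}, x ∈ C n p → P.act n p σ x ∈ C n p
  comp_mem : ∀ {m n r : ℕ} {p q s : ℤ} (hn : m + n = r + 1) (hp : p + q = s) (i : Fin n)
    {f : P.obj m p} {g : P.obj n q}, f ∈ C m p → g ∈ C n q → P.comp hn hp i f g ∈ C r s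

end NonunitalOperad

theorem OperadDerivation.isSuboperad_squareZeroLocus {k : Type u} [Field k]
    {P : NonunitalOperad.{u, v} k} {e : ℤ} (Δ : OperadDerivation P e) (he : Odd e) :
    P.IsSuboperad Δ.squareZeroLocus where
  act_mem σ x hx := by
    rw [mem_squareZeroLocus] at hx ⊢
    intro q h
    rw [SymmSeqShiftHom.map_act, hx q h, map_zero]
  comp_mem {m n r p q s} hn hp i f g hf hg := by
    rw [mem_squareZeroLocus] at hf hg ⊢
    intro s' h
    have hsign : (-1 : k) ^ (e * (p - e)) = -(-1) ^ (e * p) :=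
      neg_one_zpow_eq_neg_of_odd_sub (by
        rw [show e * (p - e) - e * p = -(e * e) by ring]; exact (he.mul he).neg)
    rw [Δ.map_map_comp Δ hn hp (sub_add_cancel p (e + e)) (sub_add_cancel q (e + e)) h, hf, hg,
      hsign]
    simp

namespace OperadHom

variable {k : Type u} [Field k] {P : NonunitalOperad.{u, v₁} k} {Q : NonunitalOperad.{u, v₂} k}
  {e : ℤ}

theorem isSuboperad_eqLocus (φ ψ : OperadHom P Q) :
    P.IsSuboperad fun n p => LinearMap.eqLocus (φ.toFun n p) (ψ.toFun n p) where
  act_mem σ x hx := by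
    simp only [LinearMap.mem_eqLocus] at hx ⊢
    rw [φ.map_act, ψ.map_act, hx]
  comp_mem hn hp i f g hf hg := by
    simp only [LinearMap.mem_eqLocus] at hf hg ⊢
    rw [φ.map_comp, ψ.map_comp, hf, hg]

/-- The elements at which `φ` commutes with the derivations `Δ` and `Δ'`. -/
def intertwiningLocus (φ : OperadHom P Q) (Δ : OperadDerivation P e) (Δ' : OperadDerivation Q e)
    (n : ℕ) (p : ℤ) : Submodule k (P.obj n p) :=
  ⨅ (q : ℤ) (h : q + e = p), LinearMap.eqLocus (φ.app ∘ₗ Δ h) (Δ' h ∘ₗ φ.app)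

/-- The homomorphism `φ` commutes with the derivations `Δ` and `Δ'`. -/
def Intertwines (φ : OperadHom P Q) (Δ : OperadDerivation P e) (Δ' : OperadDerivation Q e) :
    Prop :=
  ∀ ⦃n : ℕ⦄ ⦃p q : ℤ⦄ (h : q + e = p) (x : P.obj n p), φ (Δ h x) = Δ' h (φ x)

variable {φ : OperadHom P Q} {Δ : OperadDerivation P e} {Δ' : OperadDerivation Q e}

theorem mem_intertwiningLocus {n : ℕ} {p : ℤ} {x : P.obj n p} :
    x ∈ φ.intertwiningLocus Δ Δ' n p ↔ ∀ ⦃q⦄ (h : q + e = p), φ (Δ h x) = Δ' h (φ x) := by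
  simp [intertwiningLocus]

theorem isSuboperad_intertwiningLocus : P.IsSuboperad (φ.intertwiningLocus Δ Δ') where
  act_mem σ x hx := by
    rw [mem_intertwiningLocus] at hx ⊢
    intro q h
    rw [Δ.map_act, φ.map_act, φ.map_act, Δ'.map_act, hx]
  comp_mem {m n r p q s} hn hp i f g hf hg := by
    rw [mem_intertwiningLocus] at hf hg ⊢
    intro s' h
    rw [Δ.map_comp hn hp (sub_add_cancel p e) (sub_add_cancel q e) h (by omega) (by omega),
      map_add, map_smul, φ.map_comp, φ.map_comp, φ.map_comp, hf, hg, ← Δ'.map_comp]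

end OperadHom

namespace NonunitalOperad

variable {k : Type u} [Field k] (P : NonunitalOperad.{u, v} k)

/-- The operad `P[ε]` with `ε² = 0`, where `ε` has degree `e`; the pair `(f, f')` stands
for `f + ε f'`. It serves to encode derivations of degree `-e` as homomorphisms `P → P[ε]`. -/
def dualNumbers (e : ℤ) : NonunitalOperad.{u, v} k where
  obj n p := P.obj n p × P.obj n (p - e)
  act n p :=
    { toFun σ := (P.act n p σ).prodMap (P.act n (p - e) σ)
      map_one' := by ext <;> simp
      map_mul' σ τ := by ext <;> simp }
  subsingleton_obj_zero p :=
    have := P.subsingleton_obj_zero p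
    have := P.subsingleton_obj_zero (p - e)
    inferInstance
  comp {m n r p q s} hn hp i :=
    LinearMap.mk₂ k (fun f g => (P.comp hn hp i f.1 g.1,
      P.comp hn (by omega : p - e + q = s - e) i f.2 g.1 +
        (-1 : k) ^ (e * p) • P.comp hn (by omega : p + (q - e) = s - e) i f.1 g.2))
      (by intros; ext <;> simp; abel)
      (by intro c f g; ext <;> simp [smul_comm _ c])
      (by intros; ext <;> simp; abel)
      (by intro c f g; ext <;> simp [smul_comm _ c])
  comp_assoc {a b c ab bc abc p q r pq qr pqr} hab hbc hl hr hpq hqr hl' hr' i j i' hi f g h := by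
    have hsign : (-1 : k) ^ (e * pq) = (-1) ^ (e * p) * (-1) ^ (e * q) := by
      rw [← hpq, mul_add, zpow_add₀ (neg_ne_zero.2 one_ne_zero)]
    ext
    · exact P.comp_assoc hab hbc hl hr hpq hqr hl' hr' i j i' hi f.1 g.1 h.1
    · simp only [LinearMap.mk₂_apply, map_add, map_smul, LinearMap.add_apply, LinearMap.smul_apply]
      rw [P.comp_assoc hab hbc hl hr (by omega : p - e + q = pq - e) hqr (by omega) (by omega)
          i j i' hi f.2 g.1 h.1,
        P.comp_assoc hab hbc hl hr (by omega : p + (q - e) = pq - e)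
          (by omega : q - e + r = qr - e) (by omega) (by omega) i j i' hi f.1 g.2 h.1,
        P.comp_assoc hab hbc hl hr hpq
          (by omega : q + (r - e) = qr - e) (by omega) (by omega) i j i' hi f.1 g.1 h.2]
      simp only [hsign, smul_add, smul_smul, add_assoc]
  comp_comm {a b c ac bc abc p q r pr qr pqr} hac hbc hl hr hpr hqr hl' hr' i j hij i' hi' j' hj'
      f g h := by
    ext
    · exact P.comp_comm hac hbc hl hr hpr hqr hl' hr' i j hij i' hi' j' hj' f.1 g.1 h.1
    · simp only [LinearMap.mk₂_apply, map_add, map_smul, Prod.smul_snd]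
      rw [P.comp_comm hac hbc hl hr (by omega : p - e + r = pr - e) hqr (by omega) (by omega)
          i j hij i' hi' j' hj' f.2 g.1 h.1,
        P.comp_comm hac hbc hl hr hpr (by omega : q - e + r = qr - e) (by omega) (by omega)
          i j hij i' hi' j' hj' f.1 g.2 h.1,
        P.comp_comm hac hbc hl hr (by omega : p + (r - e) = pr - e)
          (by omega : q + (r - e) = qr - e) (by omega) (by omega)
          i j hij i' hi' j' hj' f.1 g.1 h.2]
      simp only [smul_add, smul_smul, ← zpow_add₀ (neg_ne_zero.2 (one_ne_zero (α := k)))]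
      rw [neg_one_zpow_eq_of_even_sub (k := k) (a := (p - e) * q) (b := p * q + e * q)
          ⟨-(e * q), by ring⟩, show e * p + p * (q - e) = p * q by ring,
        show e * p + (e * q + p * q) = p * q + (e * q + e * p) by ring]
      abel
  comp_act hn hp σ τ i f g := by
    ext
    · exact P.comp_act hn hp σ τ i f.1 g.1
    · simp [P.comp_act]

end NonunitalOperad

namespace OperadDerivation

variable {k : Type u} [Field k] {P : NonunitalOperad.{u, v} k} {e : ℤ}

/-- The derivation `Δ` encoded by a homomorphism `f ↦ f + ε Δ f` of operads. -/
def ofDualNumbers (φ : OperadHom P (P.dualNumbers e))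
    (hφ : ∀ {n p} (f : P.obj n p), (φ f).1 = f) : OperadDerivation P e where
  toFun {n p q} h := P.degreeCast (sub_eq_of_eq_add h.symm) ∘ₗ
    LinearMap.snd k (P.obj n p) (P.obj n (p - e)) ∘ₗ φ.app
  map_act {n p q} h σ f := by
    obtain rfl := eq_sub_of_add_eq h
    exact congrArg Prod.snd (φ.map_act σ f)
  map_comp {m n r p q s p' q' s'} hn hp hp' hq' hs' h₁ h₂ i f g := by
    obtain rfl := eq_sub_of_add_eq hp'
    obtain rfl := eq_sub_of_add_eq hq'
    obtain rfl := eq_sub_of_add_eq hs'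
    have hsnd : (φ (P.comp hn hp i f g)).2 = P.comp hn h₁ i (φ f).2 (φ g).1 +
        (-1 : k) ^ (e * p) • P.comp hn h₂ i (φ f).1 (φ g).2 :=
      congrArg Prod.snd (φ.map_comp hn hp i f g)
    rwa [hφ, hφ] at hsnd

end OperadDerivation

/-! ### Homomorphisms and derivations of free operads -/

namespace FreeOperad

variable {k : Type u} [Field k] {M : OperadCollection.{u, v} k} {P : NonunitalOperad.{u, v₁} k}
  {Q : NonunitalOperad.{u, v₂} k}

/-- Evaluation of an expression in an operad. -/
def Term.eval (f : SymmSeqHom M.toSymmSeq P.toSymmSeq) :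
    ∀ {n : ℕ} {p : ℤ}, Term M n p → P.obj n p
  | _, _, .gen x => f x
  | _, _, .zero => 0
  | _, _, .add s t => s.eval f + t.eval f
  | _, _, .smul c t => c • t.eval f
  | _, _, .act σ t => P.act _ _ σ (t.eval f)
  | _, _, .comp hn hp i s t => P.comp hn hp i (s.eval f) (t.eval f)

theorem Rel.eval_eq (f : SymmSeqHom M.toSymmSeq P.toSymmSeq) {n : ℕ} {p : ℤ} {s t : Term M n p}
    (h : Rel M s t) : s.eval f = t.eval f := by
  induction h with
  | refl t => rfl
  | symm _ ih => exact ih.symm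
  | trans _ _ ih ih' => exact ih.trans ih'
  | add _ _ ih ih' => simp only [Term.eval, ih, ih']
  | smul c _ ih => simp only [Term.eval, ih]
  | act σ _ ih => simp only [Term.eval, ih]
  | comp hn hp i _ _ ih ih' => simp only [Term.eval, ih, ih']
  | comp_assoc hab hbc hl hr hpq hqr hl' hr' i j i' hi f g h =>
    exact P.comp_assoc hab hbc hl hr hpq hqr hl' hr' i j i' hi _ _ _
  | comp_comm hac hbc hl hr hpr hqr hl' hr' i j hij i' hi' j' hj' f g h =>
    exact P.comp_comm hac hbc hl hr hpr hqr hl' hr' i j hij i' hi' j' hj' _ _ _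
  | comp_act hn hp σ τ i => exact P.comp_act hn hp σ τ i _ _
  | add_comm => exact _root_.add_comm _ _
  | add_assoc => exact _root_.add_assoc _ _ _
  | add_smul => exact _root_.add_smul _ _ _
  | mul_smul => exact SemigroupAction.mul_smul _ _ _
  | _ => simp [Term.eval, f.map_act]

/-- The homomorphism out of a free operad with given values on the generators. -/
def lift (f : SymmSeqHom M.toSymmSeq P.toSymmSeq) : OperadHom (freeOperad M) P where
  toFun n p :=
    { toFun := Quotient.lift (Term.eval f) fun _ _ h => Rel.eval_eq f h
      map_add' := by rintro ⟨x⟩ ⟨y⟩; rfl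
      map_smul' := by rintro c ⟨x⟩; rfl }
  map_act := by rintro n p σ ⟨x⟩; rfl
  map_comp := by rintro m n r p q s hn hp i ⟨x⟩ ⟨y⟩; rfl

variable (M) in
/-- The inclusion of the generators as a morphism of symmetric sequences. -/
def gen : SymmSeqHom M.toSymmSeq (freeOperad M).toSymmSeq where
  toFun := ι M _ _
  map_act σ x := mk_eq (Rel.gen_act σ x)

@[simp]
theorem lift_gen (f : SymmSeqHom M.toSymmSeq P.toSymmSeq) {n : ℕ} {p : ℤ} (x : M.obj n p) :
    lift f (gen M x) = f x := rfl

theorem obj_induction {C : ∀ (n : ℕ) (p : ℤ), (freeOperad M).obj n p → Prop}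
    (gen : ∀ n p x, C n p (gen M x)) (zero : ∀ n p, C n p 0)
    (add : ∀ n p x y, C n p x → C n p y → C n p (x + y))
    (smul : ∀ n p (c : k) x, C n p x → C n p (c • x))
    (act : ∀ n p σ x, C n p x → C n p ((freeOperad M).act n p σ x))
    (comp : ∀ {m n r : ℕ} {p q s : ℤ} (hn : m + n = r + 1) (hp : p + q = s) (i : Fin n) f g,
      C m p f → C n q g → C r s ((freeOperad M).comp hn hp i f g))
    {n : ℕ} {p : ℤ} (x : (freeOperad M).obj n p) : C n p x := by
  obtain ⟨t, rfl⟩ := mk_surjective x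
  induction t with
  | gen x => exact gen _ _ x
  | zero => exact zero _ _
  | add s t hs ht => exact add _ _ _ _ hs ht
  | smul c t ht => exact smul _ _ c _ ht
  | act σ t ht => exact act _ _ σ _ ht
  | comp hn hp i f g hf hg => exact comp hn hp i _ _ hf hg

theorem eq_zero_of_lt_two {n : ℕ} {p : ℤ} (hn : n < 2) (x : (freeOperad M).obj n p) : x = 0 := by
  induction x using obj_induction with
  | gen n p x =>
    have := M.subsingleton_obj n p hn
    rw [Subsingleton.elim x 0, map_zero]
  | zero => rfl
  | add n p x y hx hy => rw [hx hn, hy hn, add_zero]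
  | smul n p c x hx => rw [hx hn, smul_zero]
  | act n p σ x hx => rw [hx hn, map_zero]
  | comp h hp i f g hf => rw [hf (by have := i.2; omega), map_zero, LinearMap.zero_apply]

variable (M) in
/-- The decomposable elements: the span of the elements obtained from compositions of elements of
smaller arity. -/
def decomposables (n : ℕ) (p : ℤ) : Submodule k ((freeOperad M).obj n p) :=
  Submodule.span k {x | ∃ (m l : ℕ) (q s : ℤ) (hn : m + l = n + 1) (hp : q + s = p) (i : Fin l)
    (f : (freeOperad M).obj m q) (g : (freeOperad M).obj l s) (σ : Equiv.Perm (Fin n)),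
    m < n ∧ l < n ∧ x = (freeOperad M).act n p σ ((freeOperad M).comp hn hp i f g)}

theorem act_mem_decomposables {n : ℕ} {p : ℤ} (σ : Equiv.Perm (Fin n))
    {x : (freeOperad M).obj n p} (hx : x ∈ decomposables M n p) :
    (freeOperad M).act n p σ x ∈ decomposables M n p := by
  suffices decomposables M n p ≤ (decomposables M n p).comap ((freeOperad M).act n p σ) from
    this hx
  refine Submodule.span_le.2 ?_
  rintro _ ⟨m, l, q, s, hn, hp, i, f, g, τ, hm, hl, rfl⟩
  exact Submodule.subset_span ⟨m, l, q, s, hn, hp, i, f, g, σ * τ, hm, hl, by simp⟩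

theorem comp_mem_decomposables {m n r : ℕ} {p q s : ℤ} (hn : m + n = r + 1) (hp : p + q = s)
    (i : Fin n) (f : (freeOperad M).obj m p) (g : (freeOperad M).obj n q) :
    (freeOperad M).comp hn hp i f g ∈ decomposables M r s := by
  by_cases hm : m < 2
  · rw [eq_zero_of_lt_two hm f, map_zero, LinearMap.zero_apply]
    exact zero_mem _
  by_cases hn' : n < 2
  · rw [eq_zero_of_lt_two hn' g, map_zero]
    exact zero_mem _
  exact Submodule.subset_span ⟨m, n, p, q, hn, hp, i, f, g, 1, by omega, by omega, by simp⟩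

theorem exists_eq_gen_add {n : ℕ} {p : ℤ} (x : (freeOperad M).obj n p) :
    ∃ y : M.obj n p, ∃ z ∈ decomposables M n p, x = gen M y + z := by
  suffices x ∈ LinearMap.range (gen M).toFun ⊔ decomposables M n p by
    obtain ⟨_, ⟨y, rfl⟩, z, hz, h⟩ := Submodule.mem_sup.1 this
    exact ⟨y, z, hz, h.symm⟩
  induction x using obj_induction with
  | gen n p x => exact Submodule.mem_sup_left ⟨x, rfl⟩
  | zero => exact zero_mem _
  | add n p x y hx hy => exact add_mem hx hy
  | smul n p c x hx => exact Submodule.smul_mem _ c hx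
  | act n p σ x hx =>
    obtain ⟨_, ⟨x, rfl⟩, y, hy, rfl⟩ := Submodule.mem_sup.1 hx
    rw [map_add, ← (gen M).map_act]
    exact add_mem (Submodule.mem_sup_left ⟨_, rfl⟩)
      (Submodule.mem_sup_right (act_mem_decomposables σ hy))
  | comp hn hp i f g _ _ =>
    exact Submodule.mem_sup_right (comp_mem_decomposables hn hp i f g)

section Suboperad

variable {C : ∀ n p, Submodule k ((freeOperad M).obj n p)}

theorem mem_of_isSuboperad_of_le (hC : (freeOperad M).IsSuboperad C) {N : ℕ}
    (hgen : ∀ n ≤ N, ∀ p x, gen M x ∈ C n p) {n : ℕ} (hn : n ≤ N) {p : ℤ}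
    (x : (freeOperad M).obj n p) : x ∈ C n p := by
  induction x using obj_induction with
  | gen n p x => exact hgen _ hn _ _
  | zero => exact zero_mem _
  | add n p x y hx hy => exact add_mem (hx hn) (hy hn)
  | smul n p c x hx => exact Submodule.smul_mem _ c (hx hn)
  | act n p σ x hx => exact hC.act_mem σ (hx hn)
  | @comp m n r p q s h hp i f g hf hg =>
    by_cases hm : m < 2
    · rw [eq_zero_of_lt_two hm f, map_zero, LinearMap.zero_apply]
      exact zero_mem _
    · have := i.2
      exact hC.comp_mem h hp i (hf (by omega)) (hg (by omega))

theorem mem_of_isSuboperad (hC : (freeOperad M).IsSuboperad C)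
    (hgen : ∀ n p x, gen M x ∈ C n p) {n : ℕ} {p : ℤ} (x : (freeOperad M).obj n p) : x ∈ C n p :=
  mem_of_isSuboperad_of_le hC (fun _ _ => hgen _) le_rfl x

theorem decomposables_le (hC : (freeOperad M).IsSuboperad C) {n : ℕ} {p : ℤ}
    (h : ∀ m < n, ∀ q x, x ∈ C m q) : decomposables M n p ≤ C n p := by
  refine Submodule.span_le.2 ?_
  rintro _ ⟨m, l, q, s, hn, hp, i, f, g, σ, hm, hl, rfl⟩
  exact hC.act_mem σ (hC.comp_mem hn hp i (h m hm q f) (h l hl s g))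

end Suboperad

section Hom

variable {φ ψ : OperadHom (freeOperad M) P}

theorem hom_eq_of_le {N : ℕ} (h : ∀ n ≤ N, ∀ p (x : M.obj n p), φ (gen M x) = ψ (gen M x)) {n : ℕ}
    (hn : n ≤ N) {p : ℤ} (x : (freeOperad M).obj n p) : φ x = ψ x :=
  mem_of_isSuboperad_of_le (OperadHom.isSuboperad_eqLocus φ ψ) h hn x

theorem hom_eq (h : ∀ n p (x : M.obj n p), φ (gen M x) = ψ (gen M x)) {n : ℕ} {p : ℤ}
    (x : (freeOperad M).obj n p) : φ x = ψ x :=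
  hom_eq_of_le (fun _ _ => h _) le_rfl x

theorem hom_eq_of_mem_decomposables {n : ℕ}
    (h : ∀ m < n, ∀ p (x : (freeOperad M).obj m p), φ x = ψ x) {p : ℤ}
    {x : (freeOperad M).obj n p} (hx : x ∈ decomposables M n p) : φ x = ψ x :=
  decomposables_le (OperadHom.isSuboperad_eqLocus φ ψ) h hx

end Hom

section Map

variable {M' : OperadCollection.{u, w} k} (f : SymmSeqHom M.toSymmSeq M'.toSymmSeq)

/-- The homomorphism of free operads induced by a morphism of collections. -/
def map : OperadHom (freeOperad M) (freeOperad M') :=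
  lift ((gen M').comp f)

@[simp]
theorem map_gen {n : ℕ} {p : ℤ} (x : M.obj n p) : map f (gen M x) = gen M' (f x) := rfl

theorem map_map_of_le (g : SymmSeqHom M'.toSymmSeq M.toSymmSeq) {N : ℕ}
    (h : ∀ n ≤ N, ∀ p (x : M.obj n p), g (f x) = x) {n : ℕ} (hn : n ≤ N) {p : ℤ}
    (x : (freeOperad M).obj n p) : map g (map f x) = x :=
  hom_eq_of_le (φ := (map g).comp (map f)) (ψ := OperadHom.id _)
    (fun n hn p x => congrArg (gen M).toFun (h n hn p x)) hn x

theorem map_mem_decomposables (φ : OperadHom (freeOperad M) (freeOperad M')) {n : ℕ} {p : ℤ}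
    {x : (freeOperad M).obj n p} (hx : x ∈ decomposables M n p) : φ x ∈ decomposables M' n p := by
  suffices decomposables M n p ≤ (decomposables M' n p).comap φ.app from this hx
  refine Submodule.span_le.2 ?_
  rintro _ ⟨m, l, q, s, hn, hp, i, f, g, σ, hm, hl, rfl⟩
  rw [SetLike.mem_coe, Submodule.mem_comap, φ.map_act, φ.map_comp]
  exact Submodule.subset_span ⟨m, l, q, s, hn, hp, i, φ f, φ g, σ, hm, hl, rfl⟩

end Map

section Derivation

variable {e : ℤ}

theorem lift_dualNumbers_fst (f : SymmSeqHom M.toSymmSeq ((freeOperad M).dualNumbers e).toSymmSeq)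
    (hf : ∀ {n p} (x : M.obj n p), (f x).1 = gen M x) {n : ℕ} {p : ℤ}
    (x : (freeOperad M).obj n p) : (lift f x).1 = x :=
  let fst : OperadHom ((freeOperad M).dualNumbers e) (freeOperad M) :=
    { toFun := fun _ _ => LinearMap.fst k _ _
      map_act := fun _ _ => rfl
      map_comp := fun _ _ _ _ _ => rfl }
  hom_eq (φ := fst.comp (lift f)) (ψ := OperadHom.id _) (fun _ _ => hf) x

/-- The derivation of a free operad with given values on the generators. -/
def derivation (δ : SymmSeqShiftHom M.toSymmSeq (freeOperad M).toSymmSeq e) :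
    OperadDerivation (freeOperad M) e :=
  OperadDerivation.ofDualNumbers
    (lift { toFun := (gen M).toFun.prod (δ (sub_add_cancel _ e))
            map_act := fun σ x => Prod.ext ((gen M).map_act σ x) (δ.map_act _ σ x) })
    (lift_dualNumbers_fst _ fun _ => rfl)

@[simp]
theorem derivation_gen (δ : SymmSeqShiftHom M.toSymmSeq (freeOperad M).toSymmSeq e) {n : ℕ}
    {p q : ℤ} (h : q + e = p) (x : M.obj n p) : derivation δ h (gen M x) = δ h x := by
  obtain rfl := eq_sub_of_add_eq h
  rfl

/-- The differential of a free operad with given values on the generators. -/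
def differential (δ : SymmSeqShiftHom M.toSymmSeq (freeOperad M).toSymmSeq 1)
    (hδ : ∀ {n p q r} (h : q + 1 = p) (h' : r + 1 = q) (x : M.obj n p),
      derivation δ h' (δ h x) = 0) : OperadDifferential (freeOperad M) where
  d _ _ _ h := derivation δ h
  d_act := (derivation δ).map_act
  d_comp hn hp hp' hq' hs' h₁ h₂ i f g := by
    rw [(derivation δ).map_comp hn hp hp' hq' hs' h₁ h₂, one_mul]
  d_d {n p q r} h h' f := by
    have hmem : f ∈ (derivation δ).squareZeroLocus n p := by
      refine mem_of_isSuboperad ((derivation δ).isSuboperad_squareZeroLocus odd_one) ?_ f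
      intro n p x
      refine OperadDerivation.mem_squareZeroLocus.2 fun q h => ?_
      rw [SymmSeqShiftHom.comp_apply _ _ (sub_add_cancel p 1) (by omega), derivation_gen, hδ]
    rw [OperadDerivation.mem_squareZeroLocus] at hmem
    rw [← SymmSeqShiftHom.comp_apply _ _ h h' (by omega), hmem]

end Derivation

section Intertwines

variable {e : ℤ} {φ : OperadHom (freeOperad M) P} {Δ : OperadDerivation (freeOperad M) e}
  {Δ' : OperadDerivation P e}

theorem intertwines_of_le {N : ℕ}
    (hgen : ∀ n ≤ N, ∀ {p q} (h : q + e = p) (x : M.obj n p),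
      φ (Δ h (gen M x)) = Δ' h (φ (gen M x)))
    {n : ℕ} (hn : n ≤ N) {p q : ℤ} (h : q + e = p) (x : (freeOperad M).obj n p) :
    φ (Δ h x) = Δ' h (φ x) :=
  OperadHom.mem_intertwiningLocus.1 (mem_of_isSuboperad_of_le
    OperadHom.isSuboperad_intertwiningLocus (fun n hn _ x =>
      OperadHom.mem_intertwiningLocus.2 fun _ h => hgen n hn h x) hn x) h

theorem intertwines (hgen : ∀ {n p q} (h : q + e = p) (x : M.obj n p),
    φ (Δ h (gen M x)) = Δ' h (φ (gen M x))) : φ.Intertwines Δ Δ' :=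
  fun _ _ _ h x => intertwines_of_le (fun _ _ => hgen) le_rfl h x

theorem intertwines_of_mem_decomposables {n : ℕ}
    (hlt : ∀ m < n, ∀ {p q} (h : q + e = p) (x : (freeOperad M).obj m p), φ (Δ h x) = Δ' h (φ x))
    {p q : ℤ} (h : q + e = p) {x : (freeOperad M).obj n p} (hx : x ∈ decomposables M n p) :
    φ (Δ h x) = Δ' h (φ x) :=
  OperadHom.mem_intertwiningLocus.1 (decomposables_le OperadHom.isSuboperad_intertwiningLocus
    (fun m hm _ x => OperadHom.mem_intertwiningLocus.2 fun _ h => hlt m hm h x) hx) h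

end Intertwines

/-! ### Minimality in terms of decomposable elements -/

theorem IsWord.one_le {l n : ℕ} {p : ℤ} {x : (freeOperad M).obj n p} (h : IsWord l x) :
    1 ≤ l := by
  induction h with
  | gen => exact le_rfl
  | act _ _ ih => exact ih
  | comp _ _ _ _ _ ih _ => omega

theorem IsWord.mem_decomposables {l n : ℕ} {p : ℤ} {x : (freeOperad M).obj n p} (h : IsWord l x)
    (hl : 2 ≤ l) : x ∈ decomposables M n p := by
  induction h with
  | gen x => omega
  | act σ _ ih => exact act_mem_decomposables σ (ih hl)
  | comp hn hp i _ _ _ _ => exact comp_mem_decomposables hn hp i _ _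

theorem IsWord.mem_lengthGE {j l n : ℕ} {p : ℤ} {x : (freeOperad M).obj n p} (h : IsWord l x)
    (hl : j ≤ l) : x ∈ lengthGE M j n p :=
  Submodule.mem_iSup_of_mem l (Submodule.mem_iSup_of_mem hl (Submodule.subset_span h))

theorem mem_span_isWord {n : ℕ} {p : ℤ} (x : (freeOperad M).obj n p) :
    x ∈ Submodule.span k {x : (freeOperad M).obj n p | ∃ l, IsWord l x} := by
  refine mem_of_isSuboperad (C := fun n p => Submodule.span k {x | ∃ l, IsWord l x}) ?_
    (fun n p x => Submodule.subset_span ⟨1, .gen x⟩) x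
  refine ⟨fun {n p} σ x hx => ?_, fun {m n r p q s} hn hp i f g hf hg => ?_⟩
  · suffices Submodule.span k {x : (freeOperad M).obj n p | ∃ l, IsWord l x} ≤
        (Submodule.span k {x | ∃ l, IsWord l x}).comap ((freeOperad M).act n p σ) from this hx
    exact Submodule.span_le.2 fun x ⟨l, hx⟩ => Submodule.subset_span ⟨l, hx.act σ⟩
  · refine LinearMap.BilinMap.apply_apply_mem_of_mem_span
      (Submodule.span k {x : (freeOperad M).obj r s | ∃ l, IsWord l x}) _ _
      ((freeOperad M).comp hn hp i) ?_ f g hf hg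
    rintro f ⟨l, hf⟩ g ⟨l', hg⟩
    exact Submodule.subset_span ⟨l + l', hf.comp hn hp i hg⟩

theorem lengthGE_two (n : ℕ) (p : ℤ) : lengthGE M 2 n p = decomposables M n p := by
  refine le_antisymm (iSup₂_le fun j hj => Submodule.span_le.2 fun x hx =>
    IsWord.mem_decomposables hx hj) (Submodule.span_le.2 ?_)
  rintro _ ⟨m, l, q, s, hn, hp, i, f, g, σ, -, -, rfl⟩
  refine LinearMap.BilinMap.apply_apply_mem_of_mem_span ((lengthGE M 2 n p).comap
    ((freeOperad M).act n p σ)) _ _ ((freeOperad M).comp hn hp i) ?_ f g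
    (mem_span_isWord f) (mem_span_isWord g)
  rintro f ⟨a, hf⟩ g ⟨b, hg⟩
  exact ((hf.comp hn hp i hg).act σ).mem_lengthGE (add_le_add hf.one_le hg.one_le)

theorem isMinimal_iff {D : OperadDifferential (freeOperad M)} :
    IsMinimal D ↔ ∀ {n p q} (h : q + 1 = p) (x : M.obj n p),
      D.d n h (gen M x) ∈ decomposables M n q := by
  simp only [IsMinimal, lengthGE_two]
  rfl

theorem d_mem_decomposables {D : OperadDifferential (freeOperad M)} {n : ℕ} {p q : ℤ}
    (h : q + 1 = p) {x : (freeOperad M).obj n p} (hx : x ∈ decomposables M n p) :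
    D.d n h x ∈ decomposables M n q := by
  suffices decomposables M n p ≤ (decomposables M n q).comap (D.d n h) from this hx
  refine Submodule.span_le.2 ?_
  rintro _ ⟨m, l, a, b, hn, hp, i, f, g, σ, -, -, rfl⟩
  rw [SetLike.mem_coe, Submodule.mem_comap, D.d_act,
    D.d_comp hn hp (sub_add_cancel a 1) (sub_add_cancel b 1) h (by omega) (by omega)]
  refine act_mem_decomposables σ (add_mem ?_ (Submodule.smul_mem _ _ ?_)) <;>
    exact comp_mem_decomposables _ _ _ _ _

theorem IsMinimal.d_mem_decomposables {D : OperadDifferential (freeOperad M)} (hD : IsMinimal D)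
    {n : ℕ} {p q : ℤ} (h : q + 1 = p) (x : (freeOperad M).obj n p) :
    D.d n h x ∈ decomposables M n q := by
  obtain ⟨y, z, hz, rfl⟩ := exists_eq_gen_add x
  rw [map_add]
  exact add_mem (isMinimal_iff.1 hD h y) (FreeOperad.d_mem_decomposables h hz)

end FreeOperad

/-! ### Representations of finite groups -/

section Representation

variable {k G V W U : Type*} [Field k] [Group G] [Finite G] [NeZero (Nat.card G : k)]
  [AddCommGroup V] [Module k V] [AddCommGroup W] [Module k W] [AddCommGroup U] [Module k U]
  {ρ : Representation k G V} {τ : Representation k G W} {π : Representation k G U}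

theorem exists_intertwiningMap_lift (f : ρ.IntertwiningMap π) (p : τ.IntertwiningMap π)
    (h : LinearMap.range f.toLinearMap ≤ LinearMap.range p.toLinearMap) :
    ∃ F : ρ.IntertwiningMap τ, ∀ v, p (F v) = f v := by
  cases nonempty_fintype G
  have hcard : (Fintype.card G : k) ≠ 0 := by
    rw [Fintype.card_eq_nat_card]
    exact NeZero.ne _
  let _ := invertibleOfNonzero hcard
  obtain ⟨s, hs⟩ := Module.projective_lifting_property p.toLinearMap.rangeRestrict
    (f.toLinearMap.codRestrict _ fun v => h ⟨v, rfl⟩) p.toLinearMap.surjective_rangeRestrict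
  have hps (v : V) : p (s v) = f v := congrArg Subtype.val (LinearMap.congr_fun hs v)
  refine ⟨Representation.invariantsEquivIntertwiningMap ρ τ
    ⟨_, Representation.averageMap_invariant (ρ.linHom τ) s⟩, fun v => ?_⟩
  have hconj (g : G) : p (τ g (s (ρ g⁻¹ v))) = f v := by
    rw [p.isIntertwining, hps, ← f.isIntertwining, Representation.self_inv_apply]
  calc p (Representation.averageMap (ρ.linHom τ) s v)
      = (⅟(Fintype.card G : k)) • ∑ g, p (τ g (s (ρ g⁻¹ v))) := by
        simp [GroupAlgebra.average, Representation.linHom_apply]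
    _ = f v := by
        simp only [hconj]
        rw [Finset.sum_const, Finset.card_univ, ← Nat.cast_smul_eq_nsmul k, smul_smul,
          invOf_mul_self, one_smul]

theorem exists_subrepresentation_inf_eq_bot_sup_eq {B Z : Subrepresentation ρ} (hBZ : B ≤ Z) :
    ∃ N : Subrepresentation ρ, N ⊓ B = ⊥ ∧ N ⊔ B = Z := by
  obtain ⟨C, hC⟩ := exists_isCompl B
  refine ⟨Z ⊓ C, ?_, Subrepresentation.toSubmodule_injective ?_⟩
  · rw [inf_assoc, hC.symm.inf_eq_bot, inf_bot_eq]
  · have htop : C.toSubmodule ⊔ B.toSubmodule = ⊤ :=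
      congrArg Subrepresentation.toSubmodule hC.symm.sup_eq_top
    rw [Subrepresentation.toSubmodule_sup, Subrepresentation.toSubmodule_inf,
      inf_sup_assoc_of_le C.toSubmodule (show B.toSubmodule ≤ Z.toSubmodule from hBZ), htop,
      inf_top_eq]

end Representation

/-! ### Relative homology -/

namespace DGOperadHom

variable {k : Type u} [Field k] {P : NonunitalOperad.{u, v₁} k} {Q : NonunitalOperad.{u, v₂} k}
  {R : NonunitalOperad.{u, v₃} k} {D : OperadDifferential P} {E : OperadDifferential Q}
  {G : OperadDifferential R}

theorem map_d_apply (φ : DGOperadHom D E) {n : ℕ} {p q : ℤ} (h : q + 1 = p) (x : P.obj n p) :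
    φ (D.d n h x) = E.d n h (φ x) :=
  φ.map_d h x

theorem intertwines (φ : DGOperadHom D E) :
    φ.toOperadHom.Intertwines D.toDerivation E.toDerivation :=
  fun _ _ _ => φ.map_d

theorem ext {φ ψ : DGOperadHom D E} (h : ∀ {n p} (x : P.obj n p), φ x = ψ x) : φ = ψ := by
  obtain ⟨⟨f, _, _⟩, _⟩ := φ
  obtain ⟨⟨g, _, _⟩, _⟩ := ψ
  obtain rfl : f = g := funext₂ fun n p => LinearMap.ext h
  rfl

variable (D) in
/-- The identity homomorphism of a dg operad. -/
def id : DGOperadHom D D where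
  toOperadHom := OperadHom.id P
  map_d _ _ := rfl

@[simp]
theorem id_apply {n : ℕ} {p : ℤ} (x : P.obj n p) : id D x = x := rfl

/-- Composition of homomorphisms of dg operads. -/
def comp (ψ : DGOperadHom E G) (φ : DGOperadHom D E) : DGOperadHom D G where
  toOperadHom := ψ.toOperadHom.comp φ.toOperadHom
  map_d h f := (congrArg _ (φ.map_d h f)).trans (ψ.map_d h _)

@[simp]
theorem comp_apply (ψ : DGOperadHom E G) (φ : DGOperadHom D E) {n : ℕ} {p : ℤ} (x : P.obj n p) :
    ψ.comp φ x = ψ (φ x) := rfl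

theorem homologyMap_comp (ψ : DGOperadHom E G) (φ : DGOperadHom D E) (n : ℕ) (p : ℤ) :
    ⇑((ψ.comp φ).homologyMap n p) = ψ.homologyMap n p ∘ φ.homologyMap n p := by
  funext x
  obtain ⟨x, rfl⟩ := Submodule.Quotient.mk_surjective _ x
  rfl

/-- The homomorphism induces an isomorphism in homology in arity `n`. -/
def IsHomologyIsoAt (φ : DGOperadHom D E) (n : ℕ) : Prop :=
  ∀ p, Function.Bijective (φ.homologyMap n p)

namespace IsHomologyIsoAt

variable {ψ : DGOperadHom E G} {φ : DGOperadHom D E} {n : ℕ}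

theorem comp (hψ : ψ.IsHomologyIsoAt n) (hφ : φ.IsHomologyIsoAt n) :
    (ψ.comp φ).IsHomologyIsoAt n := fun p => by
  rw [homologyMap_comp]
  exact (hψ p).comp (hφ p)

theorem of_comp_left (h : (ψ.comp φ).IsHomologyIsoAt n) (hψ : ψ.IsHomologyIsoAt n) :
    φ.IsHomologyIsoAt n := fun p => by
  rw [← Function.Bijective.of_comp_iff' (hψ p), ← homologyMap_comp]
  exact h p

theorem of_comp_right (h : (ψ.comp φ).IsHomologyIsoAt n) (hφ : φ.IsHomologyIsoAt n) :
    ψ.IsHomologyIsoAt n := fun p => by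
  rw [← Function.Bijective.of_comp_iff _ (hφ p), ← homologyMap_comp]
  exact h p

theorem exists_eq (hφ : φ.IsHomologyIsoAt n) {p q r t : ℤ} (h : q + 1 = p) (h' : p + 1 = r)
    (ht : t + 1 = q) {c : P.obj n q} {s : Q.obj n p} (hc : D.d n ht c = 0)
    (hcs : φ c = E.d n h s) :
    ∃ (c' : P.obj n p) (s' : Q.obj n r), D.d n h c' = c ∧ φ c' + E.d n h' s' = s := by
  obtain ⟨b, hb⟩ : ∃ b, D.d n h b = c := by
    obtain rfl := eq_sub_of_add_eq ht
    subst h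
    refine (Submodule.Quotient.mk_eq_zero _).1 ((hφ q).1
      (a₁ := Submodule.Quotient.mk ⟨c, hc⟩) (((Submodule.Quotient.mk_eq_zero _).2 ?_).trans
        (map_zero _).symm))
    exact ⟨s, hcs.symm⟩
  have hs : E.d n h (s - φ b) = 0 := by
    rw [map_sub, ← φ.map_d_apply, hb, hcs, sub_self]
  obtain ⟨a, s', ha, hs'⟩ : ∃ (a : P.obj n p) (s' : Q.obj n r),
      D.d n h a = 0 ∧ φ a - (s - φ b) = E.d n h' s' := by
    obtain rfl := eq_sub_of_add_eq h
    subst h'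
    obtain ⟨a, ha⟩ := (hφ p).2 (Submodule.Quotient.mk ⟨s - φ b, hs⟩)
    obtain ⟨⟨a, ha'⟩, rfl⟩ := Submodule.Quotient.mk_surjective _ a
    obtain ⟨s', hs'⟩ := (Submodule.Quotient.eq _).1 ha
    exact ⟨a, s', ha', hs'.symm⟩
  refine ⟨b + a, -s', by rw [map_add, hb, ha, add_zero], ?_⟩
  rw [map_neg, ← hs', map_add]
  abel

end IsHomologyIsoAt

variable (φ : DGOperadHom D E) {n : ℕ} {p : ℤ}

/-- The cycles of degree `p` in the mapping cone of `φ`. -/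
def relCycles (n : ℕ) (p : ℤ) : Submodule k (P.obj n (p - 1) × Q.obj n p) :=
  LinearMap.ker (D.d n (sub_add_cancel _ 1) ∘ₗ LinearMap.fst k _ _) ⊓
    LinearMap.eqLocus (φ.app ∘ₗ LinearMap.fst k _ _)
      (E.d n (sub_add_cancel p 1) ∘ₗ LinearMap.snd k _ _)

theorem mem_relCycles {x : P.obj n (p - 1) × Q.obj n p} :
    x ∈ φ.relCycles n p ↔
      D.d n (sub_add_cancel _ 1) x.1 = 0 ∧ φ x.1 = E.d n (sub_add_cancel p 1) x.2 := Iff.rfl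

/-- The boundaries of degree `p` in the mapping cone of `φ`, up to signs. -/
def relBoundaries (n : ℕ) (p : ℤ) : Submodule k (P.obj n (p - 1) × Q.obj n p) :=
  LinearMap.range ((D.d n (sub_add_cancel p 1)).prod φ.app ∘ₗ LinearMap.fst k _ _ +
    LinearMap.inr k _ _ ∘ₗ E.d n rfl ∘ₗ LinearMap.snd k _ (Q.obj n (p + 1)))

theorem mem_relBoundaries {x : P.obj n (p - 1) × Q.obj n p} :
    x ∈ φ.relBoundaries n p ↔ ∃ (c : P.obj n p) (s : Q.obj n (p + 1)),
      D.d n (sub_add_cancel p 1) c = x.1 ∧ φ c + E.d n rfl s = x.2 := by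
  simp [relBoundaries, Prod.ext_iff]

variable {φ}

theorem isHomologyIsoAt_iff :
    φ.IsHomologyIsoAt n ↔ ∀ p, φ.relCycles n p ≤ φ.relBoundaries n p := by
  refine ⟨fun hφ p x hx => φ.mem_relBoundaries.2 (hφ.exists_eq _ _ _ hx.1 hx.2),
    fun hφ p => ⟨?_, ?_⟩⟩
  · have hbound {p q t : ℤ} (h : q + 1 = p) (ht : t + 1 = q) {c : P.obj n q} {s : Q.obj n p}
        (hc : D.d n ht c = 0) (hcs : φ c = E.d n h s) : ∃ b, D.d n h b = c := by
      obtain rfl := eq_sub_of_add_eq h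
      obtain rfl := eq_sub_of_add_eq ht
      obtain ⟨b, -, hb, -⟩ := φ.mem_relBoundaries.1 (hφ p (x := (c, s))
        (φ.mem_relCycles.2 ⟨hc, hcs⟩))
      exact ⟨b, hb⟩
    rw [injective_iff_map_eq_zero]
    intro a ha
    obtain ⟨⟨x, hx⟩, rfl⟩ := Submodule.Quotient.mk_surjective _ a
    obtain ⟨y, hy⟩ := (Submodule.Quotient.mk_eq_zero _).1 ha
    obtain ⟨b, hb⟩ := hbound rfl (sub_add_cancel p 1) hx hy.symm
    exact (Submodule.Quotient.mk_eq_zero _).2 ⟨b, hb⟩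
  · intro a
    obtain ⟨⟨y, hy⟩, rfl⟩ := Submodule.Quotient.mk_surjective _ a
    have hcycle : ((0 : P.obj n (p - 1)), y) ∈ φ.relCycles n p :=
      φ.mem_relCycles.2 ⟨map_zero _, (map_zero _).trans hy.symm⟩
    obtain ⟨x, z, hx, hz⟩ := φ.mem_relBoundaries.1 (hφ p hcycle)
    refine ⟨Submodule.Quotient.mk ⟨x, hx⟩, (Submodule.Quotient.eq _).2 ⟨-z, ?_⟩⟩
    calc E.d n rfl (-z) = φ x - (φ x + E.d n rfl z) := by rw [map_neg, sub_add_cancel_left]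
      _ = φ x - y := by rw [hz]

theorem isHomologyIsoAt_of_bijective (hφ : ∀ p, Function.Bijective (φ.toFun n p)) :
    φ.IsHomologyIsoAt n := by
  refine isHomologyIsoAt_iff.2 fun p ⟨c, s⟩ hx => ?_
  obtain ⟨-, hcs⟩ := φ.mem_relCycles.1 hx
  obtain ⟨b, rfl⟩ := (hφ p).2 s
  refine φ.mem_relBoundaries.2 ⟨b, 0, (hφ _).1 ?_, by rw [map_zero, add_zero]⟩
  exact (φ.map_d_apply _ b).trans hcs.symm

end DGOperadHom

/-! ### Homology isomorphisms between minimal free operads -/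

namespace FreeOperad

variable {k : Type u} [Field k] {M : OperadCollection.{u, v₁} k} {M' : OperadCollection.{u, v₂} k}
  {n : ℕ}

section Decomposables

variable {φ : OperadHom (freeOperad M) (freeOperad M')} {p : ℤ}

theorem exists_mem_decomposables_eq (hφ : ∀ m < n, ∀ p, Function.Surjective (φ.toFun m p))
    {y : (freeOperad M').obj n p} (hy : y ∈ decomposables M' n p) :
    ∃ x ∈ decomposables M n p, φ x = y := by
  suffices decomposables M' n p ≤ (decomposables M n p).map φ.app from this hy
  refine Submodule.span_le.2 ?_
  rintro _ ⟨m, l, q, s, hn, hp, i, f, g, σ, hm, hl, rfl⟩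
  obtain ⟨f, rfl⟩ := hφ m hm q f
  obtain ⟨g, rfl⟩ := hφ l hl s g
  exact ⟨_, Submodule.subset_span ⟨m, l, q, s, hn, hp, i, f, g, σ, hm, hl, rfl⟩,
    by rw [φ.map_act, φ.map_comp]⟩

theorem exists_hom_leftInverse_of_lt (hφ : ∀ m < n, ∀ p, Function.Bijective (φ.toFun m p)) :
    ∃ ψ : OperadHom (freeOperad M') (freeOperad M),
      ∀ m < n, ∀ p (x : (freeOperad M).obj m p), ψ (φ x) = x := by
  classical
  let inv (m : ℕ) (p : ℤ) (hm : m < n) : (freeOperad M').obj m p ≃ₗ[k] (freeOperad M).obj m p :=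
    (LinearEquiv.ofBijective (φ.toFun m p) (hφ m hm p)).symm
  have apply_inv {m p} (hm : m < n) (y : (freeOperad M').obj m p) : φ (inv m p hm y) = y :=
    (LinearEquiv.ofBijective (φ.toFun m p) (hφ m hm p)).apply_symm_apply y
  let g : SymmSeqHom M'.toSymmSeq (freeOperad M).toSymmSeq :=
    { toFun := fun {m p} => if hm : m < n then (inv m p hm).toLinearMap ∘ₗ (gen M').toFun else 0
      map_act := fun {m p} σ x => by
        by_cases hm : m < n
        · simp only [dif_pos hm]
          apply (hφ m hm p).1
          change φ (inv m p hm _) = φ ((freeOperad M).act m p σ (inv m p hm (gen M' x)))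
          rw [apply_inv hm, φ.map_act, apply_inv hm, (gen M').map_act]
        · simp [dif_neg hm] }
  have apply_lift {m p} (hm : m < n) (y : (freeOperad M').obj m p) : φ (lift g y) = y := by
    refine hom_eq_of_le (φ := φ.comp (lift g)) (ψ := OperadHom.id _) (fun j hj q y => ?_) le_rfl y
    change φ (g y) = gen M' y
    simp only [g, dif_pos (hj.trans_lt hm)]
    exact apply_inv (hj.trans_lt hm) _
  exact ⟨lift g, fun m hm p x => (hφ m hm p).1 (apply_lift hm _)⟩

theorem eq_zero_of_mem_decomposables (hφ : ∀ m < n, ∀ p, Function.Bijective (φ.toFun m p))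
    {x : (freeOperad M).obj n p} (hx : x ∈ decomposables M n p) (hφx : φ x = 0) : x = 0 := by
  obtain ⟨ψ, hψ⟩ := exists_hom_leftInverse_of_lt hφ
  calc x = ψ (φ x) := (hom_eq_of_mem_decomposables (φ := ψ.comp φ) (ψ := OperadHom.id _) hψ hx).symm
    _ = 0 := by rw [hφx, map_zero]

end Decomposables

variable {D : OperadDifferential (freeOperad M)} {E : OperadDifferential (freeOperad M')}

theorem surjective_of_isHomologyIsoAt {φ : DGOperadHom D E} (hE : IsMinimal E)
    (hφ : φ.IsHomologyIsoAt n) (hlt : ∀ m < n, ∀ p, Function.Bijective (φ.toFun m p)) (p : ℤ) :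
    Function.Surjective (φ.toFun n p) := by
  have hsurj m (hm : m < n) p := (hlt m hm p).2
  intro y
  obtain ⟨c, hc, hcy⟩ :=
    exists_mem_decomposables_eq hsurj (hE.d_mem_decomposables (sub_add_cancel p 1) y)
  have hDc : D.d n (sub_add_cancel _ 1) c = 0 :=
    eq_zero_of_mem_decomposables hlt (d_mem_decomposables _ hc) (by
      rw [φ.map_d_apply, hcy, E.d_d])
  obtain ⟨c', s, -, hs⟩ := hφ.exists_eq _ rfl _ hDc hcy
  obtain ⟨b, -, hb⟩ := exists_mem_decomposables_eq hsurj (hE.d_mem_decomposables rfl s)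
  exact ⟨c' + b, by rw [← hs, ← hb]; exact map_add _ _ _⟩

theorem injective_of_isHomologyIsoAt {φ : DGOperadHom D E} (hD : IsMinimal D)
    (hφ : φ.IsHomologyIsoAt n) (hlt : ∀ m < n, ∀ p, Function.Bijective (φ.toFun m p)) (p : ℤ) :
    Function.Injective (φ.toFun n p) := by
  refine (injective_iff_map_eq_zero _).2 fun x hx => ?_
  have hDx : D.d n (sub_add_cancel p 1) x = 0 :=
    eq_zero_of_mem_decomposables hlt (hD.d_mem_decomposables _ x) (by
      rw [φ.map_d_apply]
      exact (congrArg _ hx).trans (map_zero _))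
  obtain ⟨c, -, hc, -⟩ := hφ.exists_eq rfl rfl _ hDx (hx.trans (map_zero (E.d n rfl)).symm)
  exact eq_zero_of_mem_decomposables hlt (hc ▸ hD.d_mem_decomposables rfl c) hx

theorem bijective_of_isHomologyIso {φ : DGOperadHom D E} (hD : IsMinimal D) (hE : IsMinimal E)
    (hφ : φ.IsHomologyIso) (n : ℕ) (p : ℤ) : Function.Bijective (φ.toFun n p) := by
  induction n using Nat.strong_induction_on generalizing p with
  | _ n hlt =>
    exact ⟨injective_of_isHomologyIsoAt hD (hφ n) hlt p,
      surjective_of_isHomologyIsoAt hE (hφ n) hlt p⟩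

end FreeOperad

/-- The isomorphism given by a bijective homomorphism of dg operads. -/
noncomputable def DGOperadHom.isoOfBijective {k : Type u} [Field k] {P : NonunitalOperad.{u, v₁} k}
    {Q : NonunitalOperad.{u, v₂} k} {D : OperadDifferential P} {E : OperadDifferential Q}
    (φ : DGOperadHom D E) (hφ : ∀ n p, Function.Bijective (φ.toFun n p)) : DGOperadIso D E :=
  let inv n p := (LinearEquiv.ofBijective (φ.toFun n p) (hφ n p)).symm
  have apply_inv {n p} (y : Q.obj n p) : φ.toFun n p (inv n p y) = y :=
    (LinearEquiv.ofBijective (φ.toFun n p) (hφ n p)).apply_symm_apply y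
  { hom := φ
    inv :=
      { toFun := fun n p => inv n p
        map_act := fun {n p} σ y => (hφ n p).1 (by
          simp only [LinearEquiv.coe_coe, apply_inv, φ.map_act])
        map_comp := fun {m n r p q s} hn hp i f g => (hφ r s).1 (by
          simp only [LinearEquiv.coe_coe, apply_inv, φ.map_comp])
        map_d := fun {n p q} h y => (hφ n q).1 (by
          simp only [LinearEquiv.coe_coe, apply_inv, φ.map_d]) }
    hom_inv := fun n p => LinearEquiv.ofBijective_symm_apply_apply _
    inv_hom := fun _ _ => apply_inv }

/-! ### Lifting through surjective homology isomorphisms -/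

namespace SymmSeqHom

variable {k : Type u} [Field k] {A : SymmSeq.{u, v₁} k} {B : SymmSeq.{u, v₂} k}

theorem exists_update (f : SymmSeqHom A B) (N : ℕ)
    (F : ∀ p, (A.act N p).IntertwiningMap (B.act N p)) :
    ∃ g : SymmSeqHom A B, (∀ n ≠ N, ∀ p (x : A.obj n p), g x = f x) ∧
      ∀ p (x : A.obj N p), g x = F p x := by
  let f' n p : (A.act n p).IntertwiningMap (B.act n p) :=
    ⟨f.toFun, fun σ => LinearMap.ext (f.map_act σ)⟩
  let g : ∀ n p, (A.act n p).IntertwiningMap (B.act n p) := Function.update f' N F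
  have g_ne n (hn : n ≠ N) : g n = f' n := Function.update_of_ne hn _ _
  have g_self : g N = F := Function.update_self _ _ _
  refine ⟨⟨(g _ _).toLinearMap, (g _ _).isIntertwining⟩, fun n hn p x => ?_, fun p x => ?_⟩
  · exact DFunLike.congr_fun (congrFun (g_ne n hn) p) x
  · exact DFunLike.congr_fun (congrFun g_self p) x

theorem exists_limit {C : ℕ → SymmSeqHom A B → Prop} {f₀ : SymmSeqHom A B} (h₀ : C 0 f₀)
    (h : ∀ N f, C N f → ∃ g, C (N + 1) g ∧ ∀ n ≤ N, ∀ p (x : A.obj n p), g x = f x) :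
    ∃ F : SymmSeqHom A B, ∀ N, ∃ f, C N f ∧ ∀ n ≤ N, ∀ p (x : A.obj n p), F x = f x := by
  choose! step hstep hstep_eq using h
  let g (N : ℕ) : SymmSeqHom A B := Nat.rec f₀ step N
  have hg (N : ℕ) : C N (g N) := by
    induction N with
    | zero => exact h₀
    | succ N ih => exact hstep N _ ih
  have g_eq {n N : ℕ} (hN : n ≤ N) (p : ℤ) (x : A.obj n p) : g N x = g n x := by
    induction N, hN using Nat.le_induction with
    | base => rfl
    | succ N hN ih => exact (hstep_eq N _ (hg N) n hN p x).trans ih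
  exact ⟨⟨(g _).toFun, (g _).map_act⟩, fun N => ⟨g N, hg N, fun n hn p x => (g_eq hn p x).symm⟩⟩

end SymmSeqHom

theorem DGOperadHom.IsHomologyIsoAt.exists_preimage {k : Type u} [Field k]
    {P : NonunitalOperad.{u, v₁} k} {S : NonunitalOperad.{u, v₂} k} {E : OperadDifferential P}
    {G : OperadDifferential S} {π : DGOperadHom E G} {n : ℕ} (hπ : π.IsHomologyIsoAt n)
    (hsurj : ∀ p, Function.Surjective (π.toFun n p)) {p q r : ℤ} (h : q + 1 = p)
    (h' : r + 1 = q) {c : P.obj n q} {s : S.obj n p} (hc : E.d n h' c = 0)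
    (hcs : π c = G.d n h s) :
    ∃ y, E.d n h y = c ∧ π y = s := by
  obtain ⟨y, s', rfl, rfl⟩ := hπ.exists_eq h rfl h' hc hcs
  obtain ⟨t, rfl⟩ := hsurj _ s'
  refine ⟨y + E.d n rfl t, by rw [map_add, E.d_d, add_zero], ?_⟩
  rw [map_add, π.map_d_apply]

namespace FreeOperad

variable {k : Type u} [Field k] {M : OperadCollection.{u, v} k}
  {P : NonunitalOperad.{u, v₁} k} {S : NonunitalOperad.{u, v₂} k}
  {D : OperadDifferential (freeOperad M)} {E : OperadDifferential P} {G : OperadDifferential S}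
  {π : DGOperadHom E G} {ν : DGOperadHom D G}

/-- The morphism `f`, defined on generators, induces a lift of `ν` through `π` in arities `≤ N`. -/
structure IsLiftUpTo (π : DGOperadHom E G) (ν : DGOperadHom D G) (N : ℕ)
    (f : SymmSeqHom M.toSymmSeq P.toSymmSeq) : Prop where
  map_d : ∀ n ≤ N, ∀ {p q : ℤ} (h : q + 1 = p) (x : M.obj n p),
    lift f (D.d n h (gen M x)) = E.d n h (f x)
  proj_eq : ∀ n ≤ N, ∀ (p : ℤ) (x : M.obj n p), π (f x) = ν (gen M x)

namespace IsLiftUpTo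

variable {N : ℕ} {f : SymmSeqHom M.toSymmSeq P.toSymmSeq}

theorem exists_apply (hf : IsLiftUpTo π ν N f) (hD : IsMinimal D)
    (hπ : π.IsHomologyIsoAt (N + 1)) (hsurj : ∀ p, Function.Surjective (π.toFun (N + 1) p)) {p : ℤ}
    (x : M.obj (N + 1) p) :
    ∃ y : P.obj (N + 1) p, E.d (N + 1) (sub_add_cancel p 1) y =
      lift f (D.d (N + 1) (sub_add_cancel p 1) (gen M x)) ∧ π y = ν (gen M x) := by
  have hx := isMinimal_iff.1 hD (sub_add_cancel p 1) x
  refine hπ.exists_preimage hsurj (sub_add_cancel p 1) (sub_add_cancel (p - 1) 1) ?_ ?_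
  · have hcomm := intertwines_of_mem_decomposables (φ := lift f) (Δ := D.toDerivation)
      (Δ' := E.toDerivation) (fun m hm _ _ h x => intertwines_of_le hf.map_d
        (Nat.le_of_lt_succ hm) h x) (sub_add_cancel (p - 1) 1) hx
    exact hcomm.symm.trans ((congrArg _ (D.d_d _ _ _)).trans (map_zero _))
  · rw [← ν.map_d_apply]
    exact hom_eq_of_mem_decomposables (φ := π.toOperadHom.comp (lift f)) (ψ := ν.toOperadHom)
      (fun m hm p x => hom_eq_of_le hf.proj_eq (Nat.le_of_lt_succ hm) x) hx

theorem exists_succ [CharZero k] (hf : IsLiftUpTo π ν N f) (hD : IsMinimal D)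
    (hπ : π.IsHomologyIsoAt (N + 1)) (hsurj : ∀ p, Function.Surjective (π.toFun (N + 1) p)) :
    ∃ g, IsLiftUpTo π ν (N + 1) g ∧ ∀ n ≤ N, ∀ p (x : M.obj n p), g x = f x := by
  have hF (p : ℤ) : ∃ F : (M.act (N + 1) p).IntertwiningMap (P.act (N + 1) p), ∀ x,
      (E.d (N + 1) (sub_add_cancel p 1) (F x), π (F x)) =
        (lift f (D.d (N + 1) (sub_add_cancel p 1) (gen M x)), ν (gen M x)) :=
    exists_intertwiningMap_lift
      (π := (P.act (N + 1) (p - 1)).prod (S.act (N + 1) p))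
      ⟨((lift f).app ∘ₗ D.d _ (sub_add_cancel p 1) ∘ₗ (gen M).toFun).prod
        (ν.app ∘ₗ (gen M).toFun), fun σ => by
          ext x <;> simp [(gen M).map_act, D.d_act, OperadHom.map_act]⟩
      ⟨(E.d _ (sub_add_cancel p 1)).prod π.app, fun σ => by
          ext x <;> simp [E.d_act, OperadHom.map_act]⟩
      (by
        rintro _ ⟨x, rfl⟩
        obtain ⟨y, hy, hy'⟩ := hf.exists_apply hD hπ hsurj x
        exact ⟨y, Prod.ext hy hy'⟩)
  choose F hF using hF
  obtain ⟨g, hgf, hgF⟩ := f.exists_update (N + 1) F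
  have hg n (hn : n ≤ N) p (x : M.obj n p) : g x = f x := hgf n (by omega) p x
  have lift_g n (hn : n ≤ N) p (x : (freeOperad M).obj n p) : lift g x = lift f x :=
    hom_eq_of_le hg hn x
  refine ⟨g, ⟨fun n hn p q h x => ?_, fun n hn p x => ?_⟩, hg⟩
  · obtain hn | rfl := Nat.le_succ_iff.1 hn
    · rw [lift_g n hn, hg n hn, hf.map_d n hn]
    · obtain rfl := eq_sub_of_add_eq h
      rw [hom_eq_of_mem_decomposables (fun m hm => lift_g m (Nat.le_of_lt_succ hm))
        (isMinimal_iff.1 hD h x), hgF]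
      exact (congrArg Prod.fst (hF p x)).symm
  · obtain hn | rfl := Nat.le_succ_iff.1 hn
    · rw [hg n hn, hf.proj_eq n hn]
    · rw [hgF]
      exact congrArg Prod.snd (hF p x)

end IsLiftUpTo

theorem exists_lift [CharZero k] (hD : IsMinimal D) (hπ : ∀ n, 2 ≤ n → π.IsHomologyIsoAt n)
    (hsurj : ∀ n, 2 ≤ n → ∀ p, Function.Surjective (π.toFun n p)) (ν : DGOperadHom D G) :
    ∃ φ : DGOperadHom D E, ∀ n p (x : (freeOperad M).obj n p), π (φ x) = ν x := by
  let f₀ : SymmSeqHom M.toSymmSeq P.toSymmSeq := 0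
  have gen_eq {n} (hn : n ≤ 1) {p} (x : M.obj n p) : gen M x = 0 :=
    eq_zero_of_lt_two (Nat.lt_succ_of_le hn) _
  have hf₀ : IsLiftUpTo π ν 1 f₀ :=
    ⟨fun n hn p q h x => by simp [gen_eq hn, f₀], fun n hn p x => by simp [gen_eq hn, f₀]⟩
  obtain ⟨F, hF⟩ := SymmSeqHom.exists_limit (C := fun N => IsLiftUpTo π ν (N + 1)) hf₀
    fun N f hf => by
      obtain ⟨g, hg, hgf⟩ := hf.exists_succ hD (hπ _ (by omega)) (hsurj _ (by omega))
      exact ⟨g, hg, fun n hn => hgf n (Nat.le_succ_of_le hn)⟩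
  have hcomm : (lift F).Intertwines D.toDerivation E.toDerivation :=
    intertwines fun {n} _ _ h x => by
      obtain ⟨f, hf, hFf⟩ := hF n
      rw [hom_eq_of_le (ψ := lift f) hFf le_rfl, lift_gen, hFf n le_rfl]
      exact hf.map_d n n.le_succ h x
  refine ⟨⟨lift F, fun h => hcomm h⟩, fun n p => hom_eq (φ := π.toOperadHom.comp (lift F))
    (ψ := ν.toOperadHom) fun n p x => ?_⟩
  obtain ⟨f, hf, hFf⟩ := hF n
  rw [OperadHom.comp_apply, lift_gen, hFf n le_rfl]
  exact hf.proj_eq n n.le_succ p x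

end FreeOperad

/-! ### Attaching generators -/

namespace OperadCollection

variable {k : Type u} [Field k] (M : OperadCollection.{u, v₁} k) (W : OperadCollection.{u, v₂} k)

/-- The direct sum of two collections. -/
noncomputable def prod : OperadCollection.{u, max v₁ v₂} k where
  obj n p := M.obj n p × W.obj n p
  act n p := (M.act n p).prod (W.act n p)
  subsingleton_obj n p hn :=
    have := M.subsingleton_obj n p hn
    have := W.subsingleton_obj n p hn
    inferInstance

/-- The inclusion of the first summand. -/
def inl : SymmSeqHom M.toSymmSeq (M.prod W).toSymmSeq where
  toFun := LinearMap.inl k _ _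
  map_act σ _ := Prod.ext rfl (map_zero (W.act _ _ σ)).symm

/-- The inclusion of the second summand. -/
def inr : SymmSeqHom W.toSymmSeq (M.prod W).toSymmSeq where
  toFun := LinearMap.inr k _ _
  map_act σ _ := Prod.ext (map_zero (M.act _ _ σ)).symm rfl

/-- The projection to the first summand. -/
def fst : SymmSeqHom (M.prod W).toSymmSeq M.toSymmSeq where
  toFun := LinearMap.fst k _ _
  map_act _ _ := rfl

variable {M W}

theorem inl_add_inr {n : ℕ} {p : ℤ} (x : (M.prod W).obj n p) :
    inl M W x.1 + inr M W x.2 = x :=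
  Prod.ext (add_zero x.1) (zero_add x.2)

/-- The morphism out of a direct sum with given restrictions to the summands. -/
def desc {A : SymmSeq.{u, v₃} k} (f : SymmSeqHom M.toSymmSeq A) (g : SymmSeqHom W.toSymmSeq A) :
    SymmSeqHom (M.prod W).toSymmSeq A where
  toFun := f.toFun.coprod g.toFun
  map_act σ x := by
    change f (M.act _ _ σ x.1) + g (W.act _ _ σ x.2) = A.act _ _ σ (f x.1 + g x.2)
    rw [f.map_act, g.map_act, map_add]

section

variable {A : SymmSeq.{u, v₃} k} (f : SymmSeqHom M.toSymmSeq A) (g : SymmSeqHom W.toSymmSeq A)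
  {n : ℕ} {p : ℤ}

@[simp]
theorem desc_inl (x : M.obj n p) : desc f g (inl M W x) = f x :=
  LinearMap.congr_fun (LinearMap.coprod_inl ..) x

@[simp]
theorem desc_inr (x : W.obj n p) : desc f g (inr M W x) = g x :=
  LinearMap.congr_fun (LinearMap.coprod_inr ..) x

end

end OperadCollection

namespace FreeOperad

open OperadCollection

variable {k : Type u} [Field k] {M : OperadCollection.{u, v₁} k} {W : OperadCollection.{u, v₂} k}
  {e : ℤ}

section Prod

variable {P : NonunitalOperad.{u, v₃} k}

@[simp]
theorem lift_desc_map_inl (φ : OperadHom (freeOperad M) P) (f : SymmSeqHom W.toSymmSeq P.toSymmSeq)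
    {n : ℕ} {p : ℤ} (x : (freeOperad M).obj n p) :
    lift (desc (φ.toSymmSeqHom.comp (gen M)) f) (map (inl M W) x) = φ x :=
  hom_eq (φ := (lift (desc (φ.toSymmSeqHom.comp (gen M)) f)).comp (map (inl M W))) (ψ := φ)
    (fun _ _ x => desc_inl (φ.toSymmSeqHom.comp (gen M)) f x) x

theorem intertwines_of_inl_of_inr {φ : OperadHom (freeOperad (M.prod W)) P}
    {Δ : OperadDerivation (freeOperad (M.prod W)) e} {Δ' : OperadDerivation P e}
    (hinl : ∀ {n p q} (h : q + e = p) (x : M.obj n p),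
      φ (Δ h (gen _ (inl M W x))) = Δ' h (φ (gen _ (inl M W x))))
    (hinr : ∀ {n p q} (h : q + e = p) (x : W.obj n p),
      φ (Δ h (gen _ (inr M W x))) = Δ' h (φ (gen _ (inr M W x)))) : φ.Intertwines Δ Δ' :=
  intertwines fun h x => by
    rw [← inl_add_inr x, map_add, map_add, map_add, map_add, map_add, hinl, hinr]

end Prod

/-- The derivation of `F(M ⊕ W)` extending the derivation `Δ` of `F(M)`, with given values
on `W`. -/
noncomputable def extendDerivation (Δ : OperadDerivation (freeOperad M) e)
    (δ : SymmSeqShiftHom W.toSymmSeq (freeOperad (M.prod W)).toSymmSeq e) :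
    OperadDerivation (freeOperad (M.prod W)) e :=
  derivation
    { toFun h := ((map (inl M W)).app ∘ₗ Δ h ∘ₗ (gen M).toFun).coprod (δ h)
      map_act h σ x := by
        change map (inl M W) (Δ h (gen M (M.act _ _ σ x.1))) + δ h (W.act _ _ σ x.2) =
          (freeOperad (M.prod W)).act _ _ σ (map (inl M W) (Δ h (gen M x.1)) + δ h x.2)
        rw [(gen M).map_act, Δ.map_act, OperadHom.map_act, δ.map_act, map_add] }

section ExtendDerivation

variable (Δ : OperadDerivation (freeOperad M) e)
  (δ : SymmSeqShiftHom W.toSymmSeq (freeOperad (M.prod W)).toSymmSeq e)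

theorem intertwines_extendDerivation : (map (inl M W)).Intertwines Δ (extendDerivation Δ δ) :=
  intertwines fun h x => by
    rw [map_gen, extendDerivation, derivation_gen]
    change map (inl M W) (Δ h (gen M x)) = map (inl M W) (Δ h (gen M x)) + δ h 0
    rw [map_zero, add_zero]

@[simp]
theorem extendDerivation_gen_inr {n : ℕ} {p q : ℤ} (h : q + e = p) (x : W.obj n p) :
    extendDerivation Δ δ h (gen _ (inr M W x)) = δ h x := by
  rw [extendDerivation, derivation_gen]
  change map (inl M W) (Δ h (gen M 0)) + δ h x = δ h x
  simp only [map_zero, zero_add]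

end ExtendDerivation

section ExtendDifferential

variable (D : OperadDifferential (freeOperad M))
  (δ : SymmSeqShiftHom W.toSymmSeq (freeOperad (M.prod W)).toSymmSeq 1)
  (hδ : ∀ {n p q r} (h : q + 1 = p) (h' : r + 1 = q) (x : W.obj n p),
    extendDerivation D.toDerivation δ h' (δ h x) = 0)

/-- The differential of `F(M ⊕ W)` extending the differential `D` of `F(M)`, with given values
on `W`. -/
noncomputable def extendDifferential : OperadDifferential (freeOperad (M.prod W)) :=
  differential _ fun {n p q r} h h' x => by
    change extendDerivation D.toDerivation δ h' (map (inl M W) (D.d n h (gen M x.1)) + δ h x.2) = 0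
    rw [map_add, hδ, ← intertwines_extendDerivation, D.toDerivation_apply, D.d_d, map_zero,
      add_zero]

theorem extendDifferential_toDerivation :
    (extendDifferential D δ hδ).toDerivation = extendDerivation D.toDerivation δ := rfl

/-- The inclusion of `F(M)` into `F(M ⊕ W)`. -/
noncomputable def inclusion : DGOperadHom D (extendDifferential D δ hδ) where
  toOperadHom := map (inl M W)
  map_d h := intertwines_extendDerivation D.toDerivation δ h

theorem extendDifferential_gen_inr {n : ℕ} {p q : ℤ} (h : q + 1 = p) (x : W.obj n p) :
    (extendDifferential D δ hδ).d n h (gen _ (inr M W x)) = δ h x :=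
  extendDerivation_gen_inr ..

variable {D} {P : NonunitalOperad.{u, v₃} k} {E : OperadDifferential P}

/-- The homomorphism out of `F(M ⊕ W)` extending the homomorphism `φ` out of `F(M)`, with given
values on `W`. -/
noncomputable def extendHom (φ : DGOperadHom D E) (f : SymmSeqHom W.toSymmSeq P.toSymmSeq)
    (hf : ∀ {n p q} (h : q + 1 = p) (x : W.obj n p),
      lift (desc (φ.toSymmSeqHom.comp (gen M)) f) (δ h x) = E.d n h (f x)) :
    DGOperadHom (extendDifferential D δ hδ) E where
  toOperadHom := lift (desc (φ.toSymmSeqHom.comp (gen M)) f)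
  map_d h x := by
    refine intertwines_of_inl_of_inr (Δ := (extendDifferential D δ hδ).toDerivation)
      (Δ' := E.toDerivation) (fun h x => ?_) (fun h x => ?_) h x
    · rw [extendDifferential_toDerivation, ← map_gen, ← intertwines_extendDerivation,
        lift_desc_map_inl, lift_desc_map_inl]
      exact φ.map_d h _
    · rw [extendDifferential_toDerivation, extendDerivation_gen_inr, hf, lift_gen, desc_inr]
      rfl

end ExtendDifferential

end FreeOperad

/-! ### Contractible extensions -/

theorem mem_of_mem_iSup_eigenspace_of_apply_mem {k V : Type*} [Field k] [AddCommGroup V]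
    [Module k V] {T : Module.End k V} {B : Submodule k V} (hB : B ≤ B.comap T) {z : V}
    (hz : z ∈ ⨆ μ ≠ 0, T.eigenspace μ) (hTz : T z ∈ B) : z ∈ B := by
  let T' : Module.End k (V ⧸ B) := B.mapQ B T hB
  have hz₀ : B.mkQ z ∈ T'.eigenspace 0 := by
    rw [Module.End.mem_eigenspace_iff, zero_smul]
    exact (Submodule.Quotient.mk_eq_zero B).2 hTz
  have hz₁ : B.mkQ z ∈ ⨆ μ ≠ 0, T'.eigenspace μ := by
    suffices ⨆ μ ≠ 0, T.eigenspace μ ≤ (⨆ μ ≠ 0, T'.eigenspace μ).comap B.mkQ from this hz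
    refine iSup₂_le fun μ hμ x hx => Submodule.mem_iSup_of_mem μ (Submodule.mem_iSup_of_mem hμ ?_)
    rw [Module.End.mem_eigenspace_iff] at hx ⊢
    exact (congrArg B.mkQ hx).trans (map_smul B.mkQ μ x)
  exact (Submodule.Quotient.mk_eq_zero B).1
    (Submodule.disjoint_def.1 (T'.eigenspaces_iSupIndep 0) _ hz₀ hz₁)

theorem NonunitalOperad.isSuboperad_iSup {k : Type u} [Field k] {P : NonunitalOperad.{u, v} k}
    {C : ℕ → ∀ n p, Submodule k (P.obj n p)}
    (hact : ∀ a {n p} (σ : Equiv.Perm (Fin n)) {x : P.obj n p}, x ∈ C a n p →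
      P.act n p σ x ∈ C a n p)
    (hcomp : ∀ a b {m n r : ℕ} {p q s : ℤ} (hn : m + n = r + 1) (hp : p + q = s) (i : Fin n)
      {f : P.obj m p} {g : P.obj n q}, f ∈ C a m p → g ∈ C b n q →
        P.comp hn hp i f g ∈ C (a + b) r s) :
    P.IsSuboperad fun n p => ⨆ a, C a n p where
  act_mem {n p} σ x hx := by
    suffices ⨆ a, C a n p ≤ (⨆ a, C a n p).comap (P.act n p σ) from this hx
    exact iSup_le fun a x hx => Submodule.mem_iSup_of_mem a (hact a σ hx)
  comp_mem {m n r p q s} hn hp i f g hf hg := by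
    suffices ⨆ a, C a m p ≤ (⨆ c, C c r s).comap ((P.comp hn hp i).flip g) from this hf
    refine iSup_le fun a f hf => ?_
    suffices ⨆ b, C b n q ≤ (⨆ c, C c r s).comap (P.comp hn hp i f) from this hg
    exact iSup_le fun b g hg => Submodule.mem_iSup_of_mem (a + b) (hcomp a b hn hp i hf hg)

theorem OperadHom.isSuboperad_range {k : Type u} [Field k] {P : NonunitalOperad.{u, v₁} k}
    {Q : NonunitalOperad.{u, v₂} k} (φ : OperadHom P Q) :
    Q.IsSuboperad fun n p => LinearMap.range (φ.toFun n p) where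
  act_mem := by
    rintro n p σ _ ⟨x, rfl⟩
    exact ⟨_, φ.map_act σ x⟩
  comp_mem := by
    rintro m n r p q s hn hp i _ _ ⟨f, rfl⟩ ⟨g, rfl⟩
    exact ⟨_, φ.map_comp hn hp i f g⟩

namespace OperadDerivation

variable {k : Type u} [Field k] {P : NonunitalOperad.{u, v₁} k} {Q : NonunitalOperad.{u, v₂} k}
  (T : OperadDerivation P 0)

/-- The eigenspaces of a derivation of degree `0`. -/
def weightSpace (μ : k) (n : ℕ) (p : ℤ) : Submodule k (P.obj n p) :=
  Module.End.eigenspace (T (add_zero p)) μ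

variable {T}

theorem mem_weightSpace {μ : k} {n : ℕ} {p : ℤ} {x : P.obj n p} :
    x ∈ T.weightSpace μ n p ↔ T (add_zero p) x = μ • x :=
  Module.End.mem_eigenspace_iff

theorem act_mem_weightSpace {μ : k} {n : ℕ} {p : ℤ} (σ : Equiv.Perm (Fin n)) {x : P.obj n p}
    (hx : x ∈ T.weightSpace μ n p) : P.act n p σ x ∈ T.weightSpace μ n p := by
  rw [mem_weightSpace] at hx ⊢
  rw [T.map_act, hx, map_smul]

theorem comp_mem_weightSpace {μ ν : k} {m n r : ℕ} {p q s : ℤ} (hn : m + n = r + 1)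
    (hp : p + q = s) (i : Fin n) {f : P.obj m p} {g : P.obj n q} (hf : f ∈ T.weightSpace μ m p)
    (hg : g ∈ T.weightSpace ν n q) : P.comp hn hp i f g ∈ T.weightSpace (μ + ν) r s := by
  rw [mem_weightSpace] at hf hg ⊢
  rw [T.map_comp hn hp (add_zero p) (add_zero q) (add_zero s) hp hp, hf, hg]
  simp [add_smul]

variable (T) in
/-- The sum of the eigenspaces for the eigenvalues `1, 2, 3, …`. -/
def positivePart (n : ℕ) (p : ℤ) : Submodule k (P.obj n p) :=
  ⨆ a : ℕ, T.weightSpace (a + 1) n p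

theorem isSuboperad_sup_positivePart {C : ∀ n p, Submodule k (P.obj n p)} (hC : P.IsSuboperad C)
    (hC₀ : ∀ n p, C n p ≤ T.weightSpace 0 n p) :
    P.IsSuboperad fun n p => C n p ⊔ T.positivePart n p := by
  let C' : ℕ → ∀ n p, Submodule k (P.obj n p)
    | 0 => C
    | a + 1 => T.weightSpace (a + 1)
  have hle (a : ℕ) n p : C' a n p ≤ T.weightSpace a n p := by
    rcases a with - | a
    · simpa using hC₀ n p
    · simp [C']
  have hsup n p : C n p ⊔ T.positivePart n p = ⨆ a, C' a n p :=
    sup_iSup_nat_succ fun a => C' a n p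
  simp only [hsup]
  refine NonunitalOperad.isSuboperad_iSup (fun a n p σ x hx => ?_) fun a b _ _ _ _ _ _ hn hp i _ _
    hf hg => ?_
  · rcases a with - | a
    · exact hC.act_mem σ hx
    · exact act_mem_weightSpace σ hx
  · rcases hab : a + b with - | c
    · obtain ⟨rfl, rfl⟩ := Nat.add_eq_zero_iff.1 hab
      exact hC.comp_mem hn hp i hf hg
    · have hfg := comp_mem_weightSpace hn hp i (hle a _ _ hf) (hle b _ _ hg)
      rwa [← Nat.cast_add, hab, Nat.cast_succ] at hfg

theorem apply_eq_zero_of_mem_positivePart [CharZero k] {φ : OperadHom P Q}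
    (hφ : φ.Intertwines T 0) {n : ℕ} {p : ℤ} {x : P.obj n p} (hx : x ∈ T.positivePart n p) :
    φ x = 0 := by
  suffices T.positivePart n p ≤ LinearMap.ker φ.app from this hx
  refine iSup_le fun a x hx => ?_
  have h : ((a : k) + 1) • φ x = 0 := by
    rw [← map_smul, ← mem_weightSpace.1 hx, hφ, zero_apply]
  exact (smul_eq_zero.1 h).resolve_left a.cast_add_one_ne_zero

theorem mem_of_mem_positivePart_of_apply_mem [CharZero k] {n : ℕ} {p : ℤ}
    {B : Submodule k (P.obj n p)} (hB : B ≤ B.comap (T (add_zero p))) {x : P.obj n p}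
    (hx : x ∈ T.positivePart n p) (hTx : T (add_zero p) x ∈ B) : x ∈ B := by
  refine mem_of_mem_iSup_eigenspace_of_apply_mem hB ?_ hTx
  suffices T.positivePart n p ≤ ⨆ μ ≠ 0, Module.End.eigenspace (T (add_zero p)) μ from this hx
  exact iSup_le fun a => le_iSup₂_of_le (a + 1 : k) a.cast_add_one_ne_zero le_rfl

end OperadDerivation

/-- A differential on a sequence of graded vector spaces with `Σ_n`-actions, together with an
equivariant contracting homotopy. -/
structure SymmSeq.Contraction {k : Type u} [Field k] (A : SymmSeq.{u, v} k) where
  d : SymmSeqShiftHom A A 1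
  s : SymmSeqShiftHom A A (-1)
  d_d : ∀ {n p q r} (h : q + 1 = p) (h' : r + 1 = q) (x : A.obj n p), d h' (d h x) = 0
  d_s_add_s_d : ∀ {n p q r} (hs : q + -1 = p) (hd' : p + 1 = q) (hd : r + 1 = p)
    (hs' : p + -1 = r) (x : A.obj n p), d hd' (s hs x) + s hs' (d hd x) = x

namespace FreeOperad

open OperadCollection

variable {k : Type u} [Field k] {M : OperadCollection.{u, v₁} k} {W : OperadCollection.{u, v₂} k}
  (D : OperadDifferential (freeOperad M)) (c : W.Contraction)

theorem extendDerivation_contraction_d {n : ℕ} {p q r : ℤ} (h : q + 1 = p) (h' : r + 1 = q)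
    (x : W.obj n p) :
    extendDerivation D.toDerivation (((gen _).comp (inr M W)).compShiftHom c.d) h'
      (((gen _).comp (inr M W)).compShiftHom c.d h x) = 0 := by
  simp [c.d_d]

/-- The differential of `F(M ⊕ W)` extending the differentials of `F(M)` and of the contractible
collection `W`. -/
noncomputable def contractibleExtension : OperadDifferential (freeOperad (M.prod W)) :=
  extendDifferential D (((gen _).comp (inr M W)).compShiftHom c.d)
    (extendDerivation_contraction_d D c)

/-- The derivation of `F(M ⊕ W)` extending the contracting homotopy of `W` and zero on `M`. -/
noncomputable def homotopyDerivation : OperadDerivation (freeOperad (M.prod W)) (-1) :=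
  extendDerivation 0 (((gen _).comp (inr M W)).compShiftHom c.s)

/-- The graded commutator of the differential and of `homotopyDerivation`: the derivation which is
zero on `M` and the identity on `W`. -/
noncomputable def weightDerivation : OperadDerivation (freeOperad (M.prod W)) 0 :=
  (contractibleExtension D c).toDerivation.anticommutator (homotopyDerivation c) odd_one
    odd_one.neg

theorem weightDerivation_apply {n : ℕ} {p q r : ℤ} (hq : q + -1 = p) (hq' : p + 1 = q)
    (hr : r + 1 = p) (hr' : p + -1 = r) (x : (freeOperad (M.prod W)).obj n p) :
    weightDerivation D c (add_zero p) x =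
      (contractibleExtension D c).d n hq' (homotopyDerivation c hq x) +
        homotopyDerivation c hr' ((contractibleExtension D c).d n hr x) :=
  OperadDerivation.anticommutator_apply _ _ _ _ (add_zero p) hq hq' hr hr' x

/-- The retraction of `F(M ⊕ W)` onto `F(M)` which is zero on the contractible collection `W`. -/
noncomputable def retraction : DGOperadHom (contractibleExtension D c) D :=
  extendHom _ (extendDerivation_contraction_d D c) (DGOperadHom.id D) 0 fun h x => by simp

theorem retraction_map_inl {n : ℕ} {p : ℤ} (x : (freeOperad M).obj n p) :
    retraction D c (map (inl M W) x) = x :=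
  lift_desc_map_inl (OperadHom.id _) 0 x

theorem retraction_gen_inr {n : ℕ} {p : ℤ} (x : W.obj n p) :
    retraction D c (gen _ (inr M W x)) = 0 :=
  desc_inr ((OperadHom.id _).toSymmSeqHom.comp (gen M)) 0 x

theorem weightDerivation_map_inl {n : ℕ} {p : ℤ} (x : (freeOperad M).obj n p) :
    weightDerivation D c (add_zero p) (map (inl M W) x) = 0 := by
  have hd {p q} (h : q + 1 = p) (x : (freeOperad M).obj n p) :
      (contractibleExtension D c).d n h (map (inl M W) x) = map (inl M W) (D.d n h x) :=
    (intertwines_extendDerivation D.toDerivation _ h x).symm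
  have hs {p q} (h : q + -1 = p) (x : (freeOperad M).obj n p) :
      homotopyDerivation c h (map (inl M W) x) = 0 :=
    (intertwines_extendDerivation 0 _ h x).symm.trans (map_zero _)
  rw [weightDerivation_apply D c (add_neg_cancel_right p 1) rfl (sub_add_cancel p 1) rfl, hs, hd,
    hs, map_zero, add_zero]

theorem weightDerivation_gen_inr {n : ℕ} {p : ℤ} (x : W.obj n p) :
    weightDerivation D c (add_zero p) (gen _ (inr M W x)) = gen _ (inr M W x) := by
  have hd {p q} (h : q + 1 = p) (x : W.obj n p) :
      (contractibleExtension D c).d n h (gen _ (inr M W x)) = gen _ (inr M W (c.d h x)) :=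
    extendDerivation_gen_inr ..
  have hs {p q} (h : q + -1 = p) (x : W.obj n p) :
      homotopyDerivation c h (gen _ (inr M W x)) = gen _ (inr M W (c.s h x)) :=
    extendDerivation_gen_inr ..
  rw [weightDerivation_apply D c (add_neg_cancel_right p 1) rfl (sub_add_cancel p 1) rfl, hs, hd,
    hd, hs, ← map_add, ← map_add, c.d_s_add_s_d]

theorem retraction_intertwines_weightDerivation :
    (retraction D c).toOperadHom.Intertwines (weightDerivation D c) 0 := by
  refine intertwines_of_inl_of_inr (fun h x => ?_) fun h x => ?_
  all_goals obtain rfl := (add_zero _).symm.trans h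
  · rw [← map_gen, weightDerivation_map_inl, map_zero]
    rfl
  · rw [weightDerivation_gen_inr]
    exact retraction_gen_inr D c x

theorem mem_positivePart_of_retraction_eq_zero [CharZero k] {n : ℕ} {p : ℤ}
    {x : (freeOperad (M.prod W)).obj n p} (hx : retraction D c x = 0) :
    x ∈ (weightDerivation D c).positivePart n p := by
  have hsub := OperadDerivation.isSuboperad_sup_positivePart (T := weightDerivation D c)
    (map (inl M W)).isSuboperad_range (by
      rintro n p _ ⟨x, rfl⟩
      rw [OperadDerivation.mem_weightSpace, zero_smul]
      exact weightDerivation_map_inl D c x)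
  obtain ⟨_, ⟨y, rfl⟩, z, hz, rfl⟩ := Submodule.mem_sup.1 <|
    mem_of_isSuboperad hsub (fun n p m => by
      rw [← inl_add_inr m, map_add]
      refine Submodule.add_mem_sup ⟨gen M m.1, rfl⟩ (Submodule.mem_iSup_of_mem 0 ?_)
      rw [OperadDerivation.mem_weightSpace, weightDerivation_gen_inr]
      simp) x
  have hy : y = 0 := by
    rw [map_add, OperadDerivation.apply_eq_zero_of_mem_positivePart
      (retraction_intertwines_weightDerivation D c) hz, add_zero] at hx
    rw [← hx]
    exact (retraction_map_inl D c y).symm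
  rwa [hy, map_zero, zero_add]

theorem mem_boundaries_of_retraction_eq_zero [CharZero k] {n : ℕ} {p : ℤ}
    {x : (freeOperad (M.prod W)).obj n p} (hx : retraction D c x = 0)
    (hdx : (contractibleExtension D c).d n (sub_add_cancel p 1) x = 0) :
    x ∈ (contractibleExtension D c).boundaries n p := by
  have hs : p + 1 + -1 = p := add_neg_cancel_right p 1
  refine OperadDerivation.mem_of_mem_positivePart_of_apply_mem ?_
    (mem_positivePart_of_retraction_eq_zero D c hx) ?_
  · rintro _ ⟨b, rfl⟩
    refine ⟨homotopyDerivation c hs ((contractibleExtension D c).d n rfl b), ?_⟩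
    rw [weightDerivation_apply D c hs rfl (sub_add_cancel p 1) rfl, OperadDifferential.d_d,
      map_zero, add_zero]
  · refine ⟨homotopyDerivation c hs x, ?_⟩
    rw [weightDerivation_apply D c hs rfl (sub_add_cancel p 1) rfl, hdx, map_zero, add_zero]

/-- The inclusion of `F(M)` into its extension by a contractible collection. -/
noncomputable def contractibleInclusion : DGOperadHom D (contractibleExtension D c) :=
  inclusion D _ (extendDerivation_contraction_d D c)

theorem isHomologyIsoAt_contractibleInclusion [CharZero k] (n : ℕ) :
    (contractibleInclusion D c).IsHomologyIsoAt n := by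
  let i := contractibleInclusion D c
  let r := retraction D c
  have hri {p} (x : (freeOperad M).obj n p) : r (i x) = x := retraction_map_inl D c x
  refine DGOperadHom.isHomologyIsoAt_iff.2 fun p ⟨x, z⟩ hxz => ?_
  obtain ⟨-, hxz : i x = _⟩ := (DGOperadHom.mem_relCycles _).1 hxz
  have hrz : D.d n (sub_add_cancel p 1) (r z) = x := by
    rw [← r.map_d_apply, ← hxz, hri]
  obtain ⟨b, hb⟩ := mem_boundaries_of_retraction_eq_zero D c (x := z - i (r z))
    (by rw [map_sub]; exact sub_eq_zero.2 (hri _).symm)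
    (by rw [map_sub, ← i.map_d_apply, hrz, hxz, sub_self])
  exact (DGOperadHom.mem_relBoundaries _).2
    ⟨r z, b, hrz, (congrArg (i (r z) + ·) hb).trans (add_sub_cancel ..)⟩

theorem isHomologyIsoAt_retraction [CharZero k] (n : ℕ) : (retraction D c).IsHomologyIsoAt n :=
  .of_comp_right (φ := contractibleInclusion D c)
    (DGOperadHom.isHomologyIsoAt_of_bijective fun p => by
      convert Function.bijective_id using 1
      exact funext (retraction_map_inl D c))
    (isHomologyIsoAt_contractibleInclusion D c n)

end FreeOperad

/-! ### Uniqueness of minimal models -/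

namespace OperadCollection

variable {k : Type u} [Field k] {A : SymmSeq.{u, v₁} k}

section OfSubrepresentations

variable (N : ∀ n p, Subrepresentation (A.act n p)) (hN : ∀ n p, n < 2 → N n p = ⊥)

/-- The collection formed by subrepresentations of a symmetric sequence. -/
def ofSubrepresentations : OperadCollection.{u, v₁} k where
  obj n p := (N n p).toSubmodule
  act n p := (N n p).toRepresentation
  subsingleton_obj n p hn := by
    rw [hN n p hn]
    exact inferInstanceAs (Subsingleton (⊥ : Submodule k (A.obj n p)))

/-- The inclusion of a collection of subrepresentations. -/
def subtype : SymmSeqHom (ofSubrepresentations N hN).toSymmSeq A where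
  toFun := (N _ _).toSubmodule.subtype
  map_act _ _ := rfl

end OfSubrepresentations

variable (A) in
/-- The part of a symmetric sequence in arities at least `2`. -/
def truncation : OperadCollection.{u, v₁} k :=
  ofSubrepresentations (A := A) (fun n _ => if n < 2 then ⊥ else ⊤) fun _ _ hn => if_pos hn

variable (A) in
/-- The inclusion of the truncation. -/
def truncationInclusion : SymmSeqHom (truncation A).toSymmSeq A := subtype ..

theorem truncationInclusion_surjective {n : ℕ} (hn : 2 ≤ n) (p : ℤ) :
    Function.Surjective (truncationInclusion A (n := n) (p := p)) := fun x =>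
  ⟨⟨x, by simp only [if_neg hn.not_gt]; exact Submodule.mem_top⟩, rfl⟩

variable (N : OperadCollection.{u, v₁} k)

/-- The cone of the identity of a collection: the contractible collection with elements `x + d y`
for `x, y` in `N`. -/
noncomputable def cone : OperadCollection.{u, v₁} k where
  obj n p := N.obj n p × N.obj n (p + 1)
  act n p := (N.act n p).prod (N.act n (p + 1))
  subsingleton_obj n p hn :=
    have := N.subsingleton_obj n p hn
    have := N.subsingleton_obj n (p + 1) hn
    inferInstance

/-- The differential of the cone is `x + d y ↦ d x`, its contraction is `x + d y ↦ y`. -/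
noncomputable def coneContraction : N.cone.Contraction where
  d :=
    { toFun {n p q} h := LinearMap.inr k _ _ ∘ₗ N.degreeCast h.symm ∘ₗ LinearMap.fst k _ _
      map_act := by
        rintro n _ q rfl σ x
        exact Prod.ext (map_zero (N.act n q σ)).symm rfl }
  s :=
    { toFun {n p q} h := LinearMap.inl k _ _ ∘ₗ N.degreeCast (by omega) ∘ₗ LinearMap.snd k _ _
      map_act := by
        intro n p q h σ x
        obtain rfl : q = p + 1 := by omega
        exact Prod.ext rfl (map_zero (N.act n _ σ)).symm }
  d_d := by
    rintro n _ _ r rfl rfl x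
    rfl
  d_s_add_s_d := by
    rintro n _ _ r hs rfl rfl hs' x
    exact Prod.ext (zero_add x.1) (add_zero x.2)

variable {N} {P : NonunitalOperad.{u, v₂} k}

/-- The morphism `x + d y ↦ f x + d (f y)` from the cone to a dg operad. -/
noncomputable def coneDesc (f : SymmSeqHom N.toSymmSeq P.toSymmSeq) (E : OperadDifferential P) :
    SymmSeqHom N.cone.toSymmSeq P.toSymmSeq where
  toFun {n p} := f.toFun.coprod (E.d n rfl ∘ₗ f.toFun)
  map_act {n p} σ x := by
    change f (N.act n p σ x.1) + E.d n rfl (f (N.act n (p + 1) σ x.2)) =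
      P.act n p σ (f x.1 + E.d n rfl (f x.2))
    rw [f.map_act, f.map_act, E.d_act, map_add]

theorem coneDesc_d (f : SymmSeqHom N.toSymmSeq P.toSymmSeq) (E : OperadDifferential P) {n : ℕ}
    {p q : ℤ} (h : q + 1 = p) (x : N.cone.obj n p) :
    coneDesc f E (N.coneContraction.d h x) = E.d n h (coneDesc f E x) := by
  subst h
  change f 0 + E.d n rfl (f x.1) = E.d n rfl (f x.1 + E.d n rfl (f x.2))
  rw [map_zero, zero_add, map_add, E.d_d, add_zero]

end OperadCollection

namespace FreeOperad

open OperadCollection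

variable {k : Type u} [Field k] {M : OperadCollection.{u, v₁} k} {M' : OperadCollection.{u, v₂} k}
  {S : NonunitalOperad.{u, w} k} {G : OperadDifferential S}
  {D : OperadDifferential (freeOperad M)} {D' : OperadDifferential (freeOperad M')}

/-- The extension of a homomorphism `F(M) → S` to `F(M ⊕ W)`, where `W` is the cone of the
truncation of `S`; it is surjective in arities at least `2`. -/
noncomputable def coneExtension (ν : DGOperadHom D G) :
    DGOperadHom (contractibleExtension D (truncation S.toSymmSeq).coneContraction) G :=
  extendHom _ (extendDerivation_contraction_d D _) ν (coneDesc (truncationInclusion _) G)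
    fun h x => by
      rw [SymmSeqHom.compShiftHom_apply, SymmSeqHom.comp_apply, lift_gen, desc_inr, coneDesc_d]

theorem coneExtension_comp_contractibleInclusion (ν : DGOperadHom D G) :
    (coneExtension ν).comp (contractibleInclusion D _) = ν :=
  DGOperadHom.ext fun x => lift_desc_map_inl ν.toOperadHom _ x

theorem coneExtension_surjective (ν : DGOperadHom D G) {n : ℕ} (hn : 2 ≤ n) (p : ℤ) :
    Function.Surjective ((coneExtension ν).toFun n p) := fun y => by
  obtain ⟨x, rfl⟩ := truncationInclusion_surjective hn p y
  let c : (truncation S.toSymmSeq).cone.obj n p := (x, 0)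
  have hc : coneDesc (truncationInclusion _) G c = truncationInclusion _ x := by
    change truncationInclusion _ x + G.d n rfl (truncationInclusion _ 0) = _
    rw [map_zero, map_zero, add_zero]
  exact ⟨gen _ (inr M _ c), (lift_gen ..).trans ((desc_inr ..).trans hc)⟩

theorem isHomologyIsoAt_coneExtension [CharZero k] {ν : DGOperadHom D G} {n : ℕ}
    (hν : ν.IsHomologyIsoAt n) : (coneExtension ν).IsHomologyIsoAt n := by
  rw [← coneExtension_comp_contractibleInclusion ν] at hν
  exact hν.of_comp_right (isHomologyIsoAt_contractibleInclusion D _ n)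

theorem nonempty_dgOperadIso [CharZero k] {ν : DGOperadHom D G} {ν' : DGOperadHom D' G}
    (hD : IsMinimal D) (hν : ν.IsHomologyIso) (hD' : IsMinimal D') (hν' : ν'.IsHomologyIso) :
    Nonempty (DGOperadIso D D') := by
  have hπ n : (coneExtension ν').IsHomologyIsoAt n := isHomologyIsoAt_coneExtension (hν' n)
  obtain ⟨φ, hφ⟩ := exists_lift hD (fun n _ => hπ n)
    (fun _ hn => coneExtension_surjective ν' hn) ν
  obtain rfl : (coneExtension ν').comp φ = ν := DGOperadHom.ext (hφ _ _)
  have hr : ((retraction D' _).comp φ).IsHomologyIso := fun n =>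
    (isHomologyIsoAt_retraction D' _ n).comp (.of_comp_left (hν n) (hπ n))
  exact ⟨DGOperadHom.isoOfBijective _ (bijective_of_isHomologyIso hD hD' hr)⟩

end FreeOperad

/-! ### Killing relative homology -/

namespace DGOperadHom

variable {k : Type u} [Field k] {P : NonunitalOperad.{u, v₁} k} {Q : NonunitalOperad.{u, v₂} k}
  {D : OperadDifferential P} {E : OperadDifferential Q}

variable (P Q) in
/-- The symmetric sequence underlying the mapping cone of a homomorphism `P → Q` of dg operads. -/
noncomputable def relChains : SymmSeq.{u, max v₁ v₂} k where
  obj n p := P.obj n (p - 1) × Q.obj n p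
  act n p := (P.act n (p - 1)).prod (Q.act n p)

variable (φ : DGOperadHom D E)

theorem act_mem_relCycles {n : ℕ} {p : ℤ} (σ : Equiv.Perm (Fin n)) {x : (relChains P Q).obj n p}
    (hx : x ∈ φ.relCycles n p) : (relChains P Q).act n p σ x ∈ φ.relCycles n p := by
  obtain ⟨hx₁, hx₂⟩ := hx
  refine ⟨(D.d_act _ σ x.1).trans ?_, (φ.map_act σ x.1).trans ?_⟩
  · exact (congrArg _ hx₁).trans (map_zero _)
  · exact (congrArg _ hx₂).trans (E.d_act _ σ x.2).symm

theorem act_mem_relBoundaries {n : ℕ} {p : ℤ} (σ : Equiv.Perm (Fin n))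
    {x : (relChains P Q).obj n p} (hx : x ∈ φ.relBoundaries n p) :
    (relChains P Q).act n p σ x ∈ φ.relBoundaries n p := by
  obtain ⟨c, s, hc, hs⟩ := φ.mem_relBoundaries.1 hx
  refine φ.mem_relBoundaries.2 ⟨P.act n p σ c, Q.act n (p + 1) σ s, ?_, ?_⟩
  · rw [D.d_act, hc]
    rfl
  · rw [OperadHom.map_act, E.d_act, ← map_add, hs]
    rfl

theorem relBoundaries_le_relCycles (n : ℕ) (p : ℤ) : φ.relBoundaries n p ≤ φ.relCycles n p := by
  intro x hx
  obtain ⟨c, s, hc, hs⟩ := φ.mem_relBoundaries.1 hx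
  rw [mem_relCycles, ← hc, ← hs, D.d_d, φ.map_d_apply, map_add, E.d_d, add_zero]
  exact ⟨rfl, rfl⟩

theorem exists_relCycles_complement [CharZero k] (n : ℕ) (p : ℤ) :
    ∃ N : Subrepresentation ((relChains P Q).act n p),
      N.toSubmodule ⊓ φ.relBoundaries n p = ⊥ ∧
        N.toSubmodule ⊔ φ.relBoundaries n p = φ.relCycles n p := by
  let B : Subrepresentation ((relChains P Q).act n p) :=
    ⟨φ.relBoundaries n p, fun σ _ => φ.act_mem_relBoundaries σ⟩
  let Z : Subrepresentation ((relChains P Q).act n p) :=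
    ⟨φ.relCycles n p, fun σ _ => φ.act_mem_relCycles σ⟩
  have hBZ : B ≤ Z := φ.relBoundaries_le_relCycles n p
  obtain ⟨N, hinf, hsup⟩ := exists_subrepresentation_inf_eq_bot_sup_eq hBZ
  exact ⟨N, congrArg Subrepresentation.toSubmodule hinf,
    congrArg Subrepresentation.toSubmodule hsup⟩

end DGOperadHom

namespace FreeOperad

open OperadCollection DGOperadHom

variable {k : Type u} [Field k] {M : OperadCollection.{u, v₁} k} {W : OperadCollection.{u, v₂} k}

section MapInl

variable {n : ℕ} {p : ℤ}

theorem map_desc_map_inl {N : OperadCollection.{u, v₃} k} (f : SymmSeqHom M.toSymmSeq N.toSymmSeq)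
    (g : SymmSeqHom W.toSymmSeq N.toSymmSeq) (x : (freeOperad M).obj n p) :
    map (desc f g) (map (inl M W) x) = map f x :=
  hom_eq (φ := (map (desc f g)).comp (map (inl M W))) (ψ := map f)
    (fun _ _ x => by
    rw [OperadHom.comp_apply, map_gen, map_gen, map_gen, desc_inl]) x

theorem map_inl_injective : Function.Injective ((map (inl M W)).toFun n p) :=
  Function.LeftInverse.injective
    (g := (map (fst M W)).toFun n p) (map_map_of_le _ _ (fun _ _ _ _ => rfl) le_rfl)

theorem map_inl_surjective (hW : ∀ m ≤ n, ∀ p, Subsingleton (W.obj m p)) :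
    Function.Surjective ((map (inl M W)).toFun n p) :=
  Function.RightInverse.surjective (g := (map (fst M W)).toFun n p) <|
    map_map_of_le (fst M W) (inl M W)
      (fun m hm p _ => Prod.ext rfl ((hW m hm p).elim _ _)) le_rfl

theorem exists_eq_map_inl_add_gen_inr (hW : ∀ m < n, ∀ p, Subsingleton (W.obj m p))
    (x : (freeOperad (M.prod W)).obj n p) :
    ∃ (c : (freeOperad M).obj n p) (w : W.obj n p),
      map (inl M W) c + gen _ (inr M W w) = x := by
  obtain ⟨y, z, hz, rfl⟩ := exists_eq_gen_add x
  obtain ⟨c, -, rfl⟩ := exists_mem_decomposables_eq (φ := map (inl M W))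
    (fun m hm _ => map_inl_surjective fun l hl => hW l (hl.trans_lt hm)) hz
  refine ⟨gen M y.1 + c, y.2, ?_⟩
  rw [map_add, map_gen, add_right_comm, ← map_add, inl_add_inr]

end MapInl

variable {S : NonunitalOperad.{u, v₃} k} {G : OperadDifferential S}
  {D : OperadDifferential (freeOperad M)}

variable (W) in
/-- Data for attaching the generators `W` to `ν : F(M) → S`: relative cycles `(δ w, f w)` of `ν`,
where `δ w` is the differential of `w` in `F(M ⊕ W)` and `f w` is its image in `S`. -/
structure Attachment (ν : DGOperadHom D G) where
  δ : SymmSeqShiftHom W.toSymmSeq (freeOperad M).toSymmSeq 1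
  f : SymmSeqHom W.toSymmSeq S.toSymmSeq
  d_δ : ∀ {n : ℕ} {p q r : ℤ} (h : q + 1 = p) (h' : r + 1 = q) (w : W.obj n p),
    D.d n h' (δ h w) = 0
  ν_δ : ∀ {n : ℕ} {p q : ℤ} (h : q + 1 = p) (w : W.obj n p), ν (δ h w) = G.d n h (f w)

namespace Attachment

variable {ν : DGOperadHom D G} (a : Attachment W ν)

theorem extendDerivation_δ {n : ℕ} {p q r : ℤ} (h : q + 1 = p) (h' : r + 1 = q)
    (w : W.obj n p) :
    extendDerivation D.toDerivation ((map (inl M W)).toSymmSeqHom.compShiftHom a.δ) h'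
      ((map (inl M W)).toSymmSeqHom.compShiftHom a.δ h w) = 0 := by
  rw [SymmSeqHom.compShiftHom_apply, OperadHom.toSymmSeqHom_apply, ← intertwines_extendDerivation,
    D.toDerivation_apply, a.d_δ, map_zero]

/-- The differential on `F(M ⊕ W)`. -/
noncomputable def differential : OperadDifferential (freeOperad (M.prod W)) :=
  extendDifferential D _ a.extendDerivation_δ

/-- The inclusion of `F(M)` into `F(M ⊕ W)`. -/
noncomputable def inclusion : DGOperadHom D a.differential :=
  FreeOperad.inclusion D _ a.extendDerivation_δ

/-- The extension of `ν` to `F(M ⊕ W)`. -/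
noncomputable def hom : DGOperadHom a.differential G :=
  extendHom _ a.extendDerivation_δ ν a.f fun h w =>
    (lift_desc_map_inl ν.toOperadHom a.f _).trans (a.ν_δ h w)

theorem hom_comp_inclusion : a.hom.comp a.inclusion = ν :=
  DGOperadHom.ext (lift_desc_map_inl ν.toOperadHom a.f)

variable {n : ℕ}

theorem differential_add {p q : ℤ} (h : q + 1 = p) (c : (freeOperad M).obj n p)
    (w : W.obj n p) :
    a.differential.d n h (map (inl M W) c + gen _ (inr M W w)) =
      map (inl M W) (D.d n h c + a.δ h w) := by
  rw [map_add, map_add]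
  exact congrArg₂ _ (a.inclusion.map_d_apply h c).symm
    (extendDifferential_gen_inr D _ a.extendDerivation_δ h w)

theorem hom_add {p : ℤ} (c : (freeOperad M).obj n p) (w : W.obj n p) :
    a.hom (map (inl M W) c + gen _ (inr M W w)) = ν c + a.f w := by
  rw [map_add]
  exact congrArg₂ _ (lift_desc_map_inl ν.toOperadHom a.f c) ((lift_gen ..).trans (desc_inr ..))

theorem isMinimal_differential (hD : IsMinimal D)
    (hdec : ∀ {n p q} (h : q + 1 = p) (w : W.obj n p), a.δ h w ∈ decomposables M n q) :
    IsMinimal a.differential := isMinimal_iff.2 fun h x => by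
  rw [← inl_add_inr x, map_add, ← map_gen, differential_add]
  exact map_mem_decomposables _ (add_mem (isMinimal_iff.1 hD _ _) (hdec _ _))

theorem isHomologyIsoAt_hom_of_subsingleton (hν : ν.IsHomologyIsoAt n)
    (hW : ∀ m ≤ n, ∀ p, Subsingleton (W.obj m p)) : a.hom.IsHomologyIsoAt n := by
  rw [← a.hom_comp_inclusion] at hν
  exact hν.of_comp_right
    (isHomologyIsoAt_of_bijective fun p => ⟨map_inl_injective, map_inl_surjective hW⟩)

/-- The relative cycle of `ν` along which a generator is attached. -/
noncomputable def relCycle (p : ℤ) :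
    W.obj n p →ₗ[k] (freeOperad M).obj n (p - 1) × S.obj n p :=
  (a.δ (sub_add_cancel p 1)).prod a.f.toFun

variable {a}

theorem eq_zero_of_d_eq_δ (hinj : ∀ p w, a.relCycle (n := n) p w ∈ ν.relBoundaries n p → w = 0)
    {p q r : ℤ} (h : q + 1 = p) (h' : p + 1 = r) {w : W.obj n p} {c : (freeOperad M).obj n p}
    {s : S.obj n r} (hc : D.d n h c = a.δ h w) (hs : ν c + G.d n h' s = a.f w) : w = 0 := by
  subst h'
  obtain rfl := eq_sub_of_add_eq h
  exact hinj p w (ν.mem_relBoundaries.2 ⟨c, s, hc, hs⟩)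

theorem isHomologyIsoAt_hom (hW : ∀ m < n, ∀ p, Subsingleton (W.obj m p))
    (hinj : ∀ p w, a.relCycle (n := n) p w ∈ ν.relBoundaries n p → w = 0)
    (hsurj : ∀ p, ν.relCycles n p ≤ LinearMap.range (a.relCycle p) ⊔ ν.relBoundaries n p) :
    a.hom.IsHomologyIsoAt n := by
  refine isHomologyIsoAt_iff.2 fun p ⟨x, t⟩ hx => ?_
  obtain ⟨hx, hxt⟩ := a.hom.mem_relCycles.1 hx
  obtain ⟨c, w, rfl⟩ := exists_eq_map_inl_add_gen_inr hW x
  dsimp only at hx hxt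
  rw [differential_add, map_eq_zero_iff _ map_inl_injective] at hx
  rw [hom_add] at hxt
  obtain rfl : w = 0 :=
    eq_zero_of_d_eq_δ hinj _ (sub_add_cancel p 1) (c := -c) (s := t)
      (by rw [map_neg]; exact neg_eq_of_add_eq_zero_right hx)
      (by rw [map_neg]; exact neg_add_eq_of_eq_add hxt.symm)
  rw [map_zero, add_zero] at hx hxt
  obtain ⟨_, ⟨w, rfl⟩, b, hb, hwb⟩ := Submodule.mem_sup.1
    (hsurj p ((ν.mem_relCycles (x := (c, t))).2 ⟨hx, hxt⟩))
  obtain ⟨c', s, hc, hs⟩ := ν.mem_relBoundaries.1 hb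
  obtain ⟨h₁, h₂⟩ := Prod.ext_iff.1 hwb
  refine a.hom.mem_relBoundaries.2 ⟨map (inl M W) c' + gen _ (inr M W w), s, ?_, ?_⟩
  · rw [differential_add, map_zero, map_zero, add_zero, hc, add_comm]
    exact congrArg _ h₁
  · rw [hom_add, add_right_comm, hs, add_comm]
    exact h₂

section OfRelCycles

variable {N : ∀ n p, Subrepresentation ((relChains (freeOperad M) S).act n p)}
  (hN : ∀ n p, n < 2 → N n p = ⊥) (hνN : ∀ n p, (N n p).toSubmodule ≤ ν.relCycles n p)

/-- The attachment of generators indexed by subrepresentations of the relative cycles. -/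
noncomputable def ofRelCycles : Attachment (ofSubrepresentations N hN) ν where
  δ :=
    { toFun {n p q} h := (freeOperad M).degreeCast (sub_eq_of_eq_add h.symm) ∘ₗ
        LinearMap.fst k _ _ ∘ₗ (N n p).toSubmodule.subtype
      map_act := by
        intro n p q h σ x
        obtain rfl := eq_sub_of_add_eq h
        rfl }
  f :=
    { toFun {n p} := LinearMap.snd k _ _ ∘ₗ (N n p).toSubmodule.subtype
      map_act _ _ := rfl }
  d_δ {n p q r} h h' w := by
    obtain rfl := eq_sub_of_add_eq h
    obtain rfl := eq_sub_of_add_eq h'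
    exact (hνN n p w.2).1
  ν_δ {n p q} h w := by
    obtain rfl := eq_sub_of_add_eq h
    exact (hνN n p w.2).2

end OfRelCycles

end Attachment

end FreeOperad

/-! ### Existence of minimal models -/

namespace FreeOperad

open OperadCollection DGOperadHom

variable {k : Type u} [Field k] {S : NonunitalOperad.{u, v} k}

theorem isHomologyIsoAt_of_lt_two {M : OperadCollection.{u, w} k}
    {D : OperadDifferential (freeOperad M)} {G : OperadDifferential S} {φ : DGOperadHom D G} {n : ℕ}
    (hn : n < 2) (hG : ∀ p, Subsingleton (G.homology n p)) : φ.IsHomologyIsoAt n := fun p => by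
  have := subsingleton_of_forall_eq (0 : (freeOperad M).obj n p) fun x => eq_zero_of_lt_two hn x
  have := hG p
  exact ⟨Function.injective_of_subsingleton _, fun y => ⟨0, Subsingleton.elim _ _⟩⟩

/-- A minimal model of `(S, G)` through arity `N + 1`, with generators of arity at most `N + 1`. -/
structure ModelUpTo (G : OperadDifferential S) (N : ℕ) where
  M : OperadCollection.{u, max u v} k
  D : OperadDifferential (freeOperad M)
  ν : DGOperadHom D G
  subsingleton_obj : ∀ n p, N + 1 < n → Subsingleton (M.obj n p)
  isMinimal : IsMinimal D
  isHomologyIsoAt : ∀ n ≤ N + 1, ν.IsHomologyIsoAt n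

namespace ModelUpTo

variable {G : OperadDifferential S}

/-- The model without generators. -/
noncomputable def empty (hG : ∀ p, Subsingleton (G.homology 1 p)) : ModelUpTo G 0 where
  M :=
    { obj _ _ := PUnit
      act _ _ := 1
      subsingleton_obj _ _ _ := inferInstanceAs (Subsingleton PUnit) }
  D := differential 0 fun _ _ _ => by
    rw [SymmSeqShiftHom.zero_apply, map_zero]
  ν :=
    { toOperadHom := lift 0
      map_d h x := intertwines (Δ := derivation 0) (Δ' := G.toDerivation) (fun h x => by
        rw [derivation_gen, lift_gen, SymmSeqShiftHom.zero_apply, SymmSeqHom.zero_apply, map_zero,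
          map_zero]) h x }
  subsingleton_obj _ _ _ := inferInstanceAs (Subsingleton PUnit)
  isMinimal := isMinimal_iff.2 fun h x => by
    change derivation 0 h _ ∈ _
    rw [derivation_gen]
    exact zero_mem _
  isHomologyIsoAt n hn := isHomologyIsoAt_of_lt_two (Nat.lt_succ_of_le hn) fun p => by
    obtain rfl | rfl := Nat.le_one_iff_eq_zero_or_eq_one.1 hn
    · have := S.subsingleton_obj_zero p
      infer_instance
    · exact hG p

variable {N : ℕ} (X : ModelUpTo G N)

theorem mem_decomposables {n : ℕ} (hn : N + 1 < n) {p : ℤ} (x : (freeOperad X.M).obj n p) :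
    x ∈ decomposables X.M n p := by
  obtain ⟨y, z, hz, rfl⟩ := exists_eq_gen_add x
  obtain rfl : y = 0 := (X.subsingleton_obj n p hn).elim _ _
  rwa [map_zero, zero_add]

section Next

variable [CharZero k]

/-- Representatives of the relative homology in arity `N + 2`. -/
noncomputable def relHomologyReps (n : ℕ) (p : ℤ) :
    Subrepresentation ((relChains (freeOperad X.M) S).act n p) :=
  if n = N + 2 then (X.ν.exists_relCycles_complement n p).choose else ⊥

theorem relHomologyReps_of_ne {n : ℕ} (hn : n ≠ N + 2) (p : ℤ) : X.relHomologyReps n p = ⊥ :=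
  if_neg hn

theorem relHomologyReps_inf_relBoundaries (p : ℤ) :
    (X.relHomologyReps (N + 2) p).toSubmodule ⊓ X.ν.relBoundaries (N + 2) p = ⊥ := by
  rw [relHomologyReps, if_pos rfl]
  exact (X.ν.exists_relCycles_complement (N + 2) p).choose_spec.1

theorem relHomologyReps_sup_relBoundaries (p : ℤ) :
    (X.relHomologyReps (N + 2) p).toSubmodule ⊔ X.ν.relBoundaries (N + 2) p =
      X.ν.relCycles (N + 2) p := by
  rw [relHomologyReps, if_pos rfl]
  exact (X.ν.exists_relCycles_complement (N + 2) p).choose_spec.2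

theorem relHomologyReps_le_relCycles (n : ℕ) (p : ℤ) :
    (X.relHomologyReps n p).toSubmodule ≤ X.ν.relCycles n p := by
  obtain rfl | hn := eq_or_ne n (N + 2)
  · exact le_sup_left.trans (X.relHomologyReps_sup_relBoundaries p).le
  · rw [relHomologyReps_of_ne X hn]
    exact bot_le

/-- The generators of arity `N + 2` which kill the relative homology in that arity. -/
noncomputable def newGenerators : OperadCollection.{u, max u v} k :=
  ofSubrepresentations X.relHomologyReps fun _ p hn => X.relHomologyReps_of_ne (by omega) p

theorem subsingleton_newGenerators {n : ℕ} (hn : n ≠ N + 2) (p : ℤ) :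
    Subsingleton (X.newGenerators.obj n p) := by
  change Subsingleton (X.relHomologyReps n p).toSubmodule
  rw [relHomologyReps_of_ne X hn]
  exact inferInstanceAs (Subsingleton (⊥ : Submodule k _))

/-- The attachment of the new generators. -/
noncomputable def attachment : Attachment X.newGenerators X.ν :=
  .ofRelCycles _ X.relHomologyReps_le_relCycles

theorem range_relCycle_attachment (n : ℕ) (p : ℤ) :
    LinearMap.range (X.attachment.relCycle (n := n) p) = (X.relHomologyReps n p).toSubmodule :=
  Submodule.range_subtype _

theorem isHomologyIsoAt_attachment_hom {n : ℕ} (hn : n ≤ N + 2) :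
    X.attachment.hom.IsHomologyIsoAt n := by
  obtain hn | rfl := Nat.le_succ_iff.1 hn
  · exact X.attachment.isHomologyIsoAt_hom_of_subsingleton (X.isHomologyIsoAt n hn)
      fun m hm => X.subsingleton_newGenerators (by omega)
  refine Attachment.isHomologyIsoAt_hom (fun m hm => X.subsingleton_newGenerators hm.ne)
    (fun p w hw => ?_) fun p => ?_
  · exact Subtype.ext ((Submodule.eq_bot_iff _).1 (X.relHomologyReps_inf_relBoundaries p) _
      ⟨w.2, hw⟩)
  · rw [range_relCycle_attachment]
    exact (X.relHomologyReps_sup_relBoundaries p).ge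

/-- The extension of a model to the next arity. -/
noncomputable def next : ModelUpTo G (N + 1) where
  M := X.M.prod X.newGenerators
  D := X.attachment.differential
  ν := X.attachment.hom
  subsingleton_obj n p hn :=
    have := X.subsingleton_obj n p (by omega)
    have := X.subsingleton_newGenerators (n := n) (by omega) p
    inferInstanceAs (Subsingleton (X.M.obj n p × X.newGenerators.obj n p))
  isMinimal := X.attachment.isMinimal_differential X.isMinimal fun {n p _} h w => by
    obtain rfl | hn := eq_or_ne n (N + 2)
    · exact X.mem_decomposables (by omega) _
    · obtain rfl : w = 0 := (X.subsingleton_newGenerators hn p).elim _ _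
      rw [map_zero]
      exact zero_mem _
  isHomologyIsoAt _ := X.isHomologyIsoAt_attachment_hom

end Next

end ModelUpTo

end FreeOperad

namespace FreeOperad

open OperadCollection DGOperadHom

variable {k : Type u} [Field k] [CharZero k] {S : NonunitalOperad.{u, v} k}
  {G : OperadDifferential S}

namespace ModelUpTo

variable (X₀ : ModelUpTo G 0)

/-- The sequence of successive extensions of a model. -/
noncomputable def stage : ∀ n, ModelUpTo G n
  | 0 => X₀
  | n + 1 => (stage n).next

/-- The collection of the generators of all stages. Since those of the `n`-th stage are concentrated
in arity `n + 2`, the product is also the direct sum. -/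
noncomputable def limitCollection : OperadCollection.{u, max u v} k where
  obj j p := ∀ n, (X₀.stage n).newGenerators.obj j p
  act j p :=
    { toFun σ := LinearMap.pi fun n =>
        (X₀.stage n).newGenerators.act j p σ ∘ₗ LinearMap.proj n
      map_one' := by
        ext
        simp
      map_mul' σ τ := by
        ext
        simp }
  subsingleton_obj j p hj :=
    have := fun n => (X₀.stage n).newGenerators.subsingleton_obj j p hj
    inferInstance

/-- The projection onto the generators of a stage. -/
noncomputable def toStage :
    ∀ n, SymmSeqHom X₀.limitCollection.toSymmSeq (X₀.stage n).M.toSymmSeq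
  | 0 => 0
  | n + 1 =>
    { toFun := (toStage n).toFun.prod
        (LinearMap.proj (φ := fun n => (X₀.stage n).newGenerators.obj _ _) n)
      map_act σ x := Prod.ext ((toStage n).map_act σ x) rfl }

/-- The inclusion of the generators added to a stage. -/
noncomputable def singleGenerator (n : ℕ) :
    SymmSeqHom (X₀.stage n).newGenerators.toSymmSeq X₀.limitCollection.toSymmSeq where
  toFun {j p} := LinearMap.single k (fun n => (X₀.stage n).newGenerators.obj j p) n
  map_act {j p} σ x := funext fun i =>
    (Pi.apply_single (fun i => (X₀.stage i).newGenerators.act j p σ) (fun _ => map_zero _)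
      n x i).symm

/-- The inclusion of the generators of a stage. -/
noncomputable def ofStage :
    ∀ n, SymmSeqHom (X₀.stage n).M.toSymmSeq X₀.limitCollection.toSymmSeq
  | 0 => 0
  | n + 1 => desc (ofStage n) (X₀.singleGenerator n)

variable {j n : ℕ} {p : ℤ}

theorem toStage_succ (m : X₀.limitCollection.obj j p) :
    X₀.toStage (n + 1) m = (X₀.toStage n m, m n) := rfl

theorem ofStage_succ (x : (X₀.stage n).M.obj j p) (w : (X₀.stage n).newGenerators.obj j p) :
    X₀.ofStage (n + 1) (x, w) = X₀.ofStage n x + X₀.singleGenerator n w := rfl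

theorem limitCollection_add_apply (m m' : X₀.limitCollection.obj j p) (i : ℕ) :
    (m + m') i = m i + m' i := rfl

theorem singleGenerator_same (w : (X₀.stage n).newGenerators.obj j p) :
    X₀.singleGenerator n w n = w :=
  Pi.single_eq_same (M := fun n => (X₀.stage n).newGenerators.obj j p) n w

theorem singleGenerator_of_ne {i : ℕ} (h : i ≠ n) (w : (X₀.stage n).newGenerators.obj j p) :
    X₀.singleGenerator n w i = 0 :=
  Pi.single_eq_of_ne (M := fun n => (X₀.stage n).newGenerators.obj j p) h w

theorem toStage_singleGenerator {i : ℕ} (h : n ≤ i) (w : (X₀.stage i).newGenerators.obj j p) :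
    X₀.toStage n (X₀.singleGenerator i w) = 0 := by
  induction n with
  | zero => rfl
  | succ n ih =>
    rw [toStage_succ, ih (by omega), singleGenerator_of_ne X₀ (by omega)]
    rfl

theorem ofStage_apply_of_le {i : ℕ} (h : n ≤ i) (x : (X₀.stage n).M.obj j p) :
    X₀.ofStage n x i = 0 := by
  induction n with
  | zero => rfl
  | succ n ih =>
    obtain ⟨x, w⟩ := x
    rw [ofStage_succ, limitCollection_add_apply, ih (by omega) x,
      singleGenerator_of_ne X₀ (by omega), add_zero]

theorem ofStage_toStage_apply_of_lt {i : ℕ} (h : i < n) (m : X₀.limitCollection.obj j p) :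
    X₀.ofStage n (X₀.toStage n m) i = m i := by
  induction n with
  | zero => omega
  | succ n ih =>
    rw [toStage_succ, ofStage_succ, limitCollection_add_apply]
    obtain h | rfl := Nat.lt_succ_iff_lt_or_eq.1 h
    · rw [ih h, singleGenerator_of_ne X₀ (by omega), add_zero]
    · rw [ofStage_apply_of_le X₀ le_rfl, singleGenerator_same, zero_add]

theorem toStage_ofStage (x : (X₀.stage n).M.obj j p) : X₀.toStage n (X₀.ofStage n x) = x := by
  induction n with
  | zero =>
    have : Subsingleton (X₀.M.obj j p) := by
      by_cases hj : j < 2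
      · exact X₀.M.subsingleton_obj j p hj
      · exact X₀.subsingleton_obj j p (by omega)
    exact Subsingleton.elim (α := X₀.M.obj j p) _ _
  | succ n ih =>
    obtain ⟨x, w⟩ := x
    rw [toStage_succ, ofStage_succ, map_add, ih, toStage_singleGenerator X₀ le_rfl, add_zero,
      limitCollection_add_apply, ofStage_apply_of_le X₀ le_rfl, singleGenerator_same, zero_add]

theorem ofStage_toStage (hj : j ≤ n + 1) (m : X₀.limitCollection.obj j p) :
    X₀.ofStage n (X₀.toStage n m) = m := funext fun i => by
  by_cases h : i < n
  · exact X₀.ofStage_toStage_apply_of_lt h m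
  · exact ((X₀.stage i).subsingleton_newGenerators (by omega) p).elim _ _

theorem bijective_map_ofStage (hj : j ≤ n + 1) (p : ℤ) :
    Function.Bijective ((map (X₀.ofStage n)).toFun j p) :=
  Function.bijective_iff_has_inverse.2 ⟨(map (X₀.toStage n)).toFun j p,
    map_map_of_le _ _ (fun _ _ _ => X₀.toStage_ofStage) le_rfl,
    map_map_of_le _ _ (fun _ hi _ => X₀.ofStage_toStage hi) hj⟩

theorem map_ofStage_inl (x : (freeOperad (X₀.stage n).M).obj j p) :
    map (X₀.ofStage (n + 1)) (map (inl _ (X₀.stage n).newGenerators) x) =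
      map (X₀.ofStage n) x :=
  map_desc_map_inl (X₀.ofStage n) (X₀.singleGenerator n) x

theorem toStage_succ_of_ne (hj : j ≠ n + 2) (m : X₀.limitCollection.obj j p) :
    X₀.toStage (n + 1) m = inl _ (X₀.stage n).newGenerators (X₀.toStage n m) :=
  Prod.ext rfl (((X₀.stage n).subsingleton_newGenerators hj p).elim _ _)

end ModelUpTo

end FreeOperad

namespace FreeOperad

open OperadCollection DGOperadHom

variable {k : Type u} [Field k] [CharZero k] {S : NonunitalOperad.{u, v} k}
  {G : OperadDifferential S}

namespace ModelUpTo

variable (X₀ : ModelUpTo G 0) {j n : ℕ} {p q : ℤ}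

theorem map_ofStage_d_toStage (hj : j - 1 ≤ n) (h : q + 1 = p) (m : X₀.limitCollection.obj j p) :
    map (X₀.ofStage n) ((X₀.stage n).D.d j h (gen _ (X₀.toStage n m))) =
      map (X₀.ofStage (j - 1))
        ((X₀.stage (j - 1)).D.d j h (gen _ (X₀.toStage (j - 1) m))) := by
  induction n, hj using Nat.le_induction with
  | base => rfl
  | succ n hn ih =>
    rw [← ih, toStage_succ_of_ne X₀ (by omega)]
    have hd := (X₀.stage n).attachment.inclusion.map_d h (gen _ (X₀.toStage n m))
    exact (congrArg (map (X₀.ofStage (n + 1))).app hd.symm).trans (X₀.map_ofStage_inl _)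

theorem ν_toStage (hj : j - 1 ≤ n) (m : X₀.limitCollection.obj j p) :
    (X₀.stage n).ν (gen _ (X₀.toStage n m)) =
      (X₀.stage (j - 1)).ν (gen _ (X₀.toStage (j - 1) m)) := by
  induction n, hj using Nat.le_induction with
  | base => rfl
  | succ n hn ih =>
    rw [← ih, toStage_succ_of_ne X₀ (by omega)]
    exact lift_desc_map_inl (X₀.stage n).ν.toOperadHom _ (gen _ (X₀.toStage n m))

/-- The differential on the generators of the limit. All generators of arity `j` are present in
stage `j - 1`. -/
noncomputable def limitShift :
    SymmSeqShiftHom X₀.limitCollection.toSymmSeq (freeOperad X₀.limitCollection).toSymmSeq 1 where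
  toFun {j _ _} h := (map (X₀.ofStage (j - 1))).app ∘ₗ (X₀.stage (j - 1)).D.d j h ∘ₗ
    (gen _).toFun ∘ₗ (X₀.toStage (j - 1)).toFun
  map_act {j _ _} h σ m := by
    simp only [LinearMap.comp_apply]
    rw [SymmSeqHom.map_act, SymmSeqHom.map_act, OperadDifferential.d_act, OperadHom.map_act]

theorem limitShift_apply (h : q + 1 = p) (m : X₀.limitCollection.obj j p) :
    X₀.limitShift h m = map (X₀.ofStage (j - 1))
      ((X₀.stage (j - 1)).D.d j h (gen _ (X₀.toStage (j - 1) m))) := rfl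

theorem intertwines_derivation_limitShift (n : ℕ) :
    (map (X₀.ofStage n)).Intertwines (X₀.stage n).D.toDerivation (derivation X₀.limitShift) :=
  intertwines fun {j p q} h x => by
    by_cases hj : n + 1 < j
    · obtain rfl : x = 0 := ((X₀.stage n).subsingleton_obj j p hj).elim _ _
      simp only [map_zero]
    · rw [map_gen, derivation_gen, limitShift_apply, ← map_ofStage_d_toStage X₀ (n := n) (by omega),
        toStage_ofStage, OperadDifferential.toDerivation_apply]

/-- The differential of the limit. -/
noncomputable def limitDifferential : OperadDifferential (freeOperad X₀.limitCollection) :=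
  differential X₀.limitShift fun h h' m => by
    rw [limitShift_apply, ← intertwines_derivation_limitShift,
      OperadDifferential.toDerivation_apply, OperadDifferential.d_d, map_zero]

/-- The inclusion of a stage in the limit. -/
noncomputable def stageInclusion (n : ℕ) : DGOperadHom (X₀.stage n).D X₀.limitDifferential where
  toOperadHom := map (X₀.ofStage n)
  map_d h x := X₀.intertwines_derivation_limitShift n h x

/-- The homomorphism of operads underlying the minimal model. -/
noncomputable def limitOperadHom : OperadHom (freeOperad X₀.limitCollection) S :=
  lift
    { toFun {j _} := (X₀.stage (j - 1)).ν.app ∘ₗ (gen _).toFun ∘ₗ (X₀.toStage (j - 1)).toFun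
      map_act {j _} σ m := by
        simp only [LinearMap.comp_apply]
        rw [SymmSeqHom.map_act, SymmSeqHom.map_act, OperadHom.map_act] }

theorem limitOperadHom_map_ofStage (x : (freeOperad (X₀.stage n).M).obj j p) :
    X₀.limitOperadHom (map (X₀.ofStage n) x) = (X₀.stage n).ν x := by
  refine hom_eq (φ := X₀.limitOperadHom.comp (map (X₀.ofStage n)))
    (ψ := (X₀.stage n).ν.toOperadHom) (fun j p x => ?_) x
  by_cases hj : n + 1 < j
  · obtain rfl : x = 0 := ((X₀.stage n).subsingleton_obj j p hj).elim _ _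
    simp only [map_zero]
  · have h := X₀.ν_toStage (n := n) (by omega) (X₀.ofStage n x)
    rw [toStage_ofStage] at h
    exact h.symm

/-- The minimal model obtained as the union of all stages. -/
noncomputable def limitHom : DGOperadHom X₀.limitDifferential G where
  toOperadHom := X₀.limitOperadHom
  map_d h x := intertwines (Δ := derivation X₀.limitShift) (Δ' := G.toDerivation)
    (fun {j _ _} h m => by
      rw [derivation_gen, limitShift_apply, limitOperadHom_map_ofStage]
      exact (X₀.stage (j - 1)).ν.map_d h _) h x

theorem limitHom_comp_stageInclusion (n : ℕ) :
    X₀.limitHom.comp (X₀.stageInclusion n) = (X₀.stage n).ν :=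
  DGOperadHom.ext fun x => X₀.limitOperadHom_map_ofStage x

theorem isMinimal_limitDifferential : IsMinimal X₀.limitDifferential :=
  isMinimal_iff.2 fun {j _ _} h m => by
    change derivation X₀.limitShift h (gen _ m) ∈ _
    rw [derivation_gen, limitShift_apply]
    exact map_mem_decomposables _ ((X₀.stage (j - 1)).isMinimal.d_mem_decomposables h _)

theorem isHomologyIso_limitHom : X₀.limitHom.IsHomologyIso := fun n => by
  have hν := (X₀.stage n).isHomologyIsoAt n n.le_succ
  rw [← limitHom_comp_stageInclusion] at hν
  exact hν.of_comp_right (isHomologyIsoAt_of_bijective (X₀.bijective_map_ofStage n.le_succ))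

end ModelUpTo

theorem exists_minimal_model (hG : ∀ p, Subsingleton (G.homology 1 p)) :
    ∃ (M : OperadCollection.{u, max u v} k) (D : OperadDifferential (freeOperad M))
      (ν : DGOperadHom D G), IsMinimal D ∧ ν.IsHomologyIso :=
  ⟨_, _, _, (ModelUpTo.empty hG).isMinimal_limitDifferential,
    (ModelUpTo.empty hG).isHomologyIso_limitHom⟩

end FreeOperad

theorem mainTheorem1_general {k : Type u} [Field k] [CharZero k] (S : NonunitalOperad.{u, v} k)
    (dS : OperadDifferential S) :
    ((∀ p, Subsingleton (dS.homology 1 p)) →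
      ∃ (M : OperadCollection.{u, max u v} k) (d : OperadDifferential (freeOperad M))
        (ν : DGOperadHom d dS), FreeOperad.IsMinimal d ∧ ν.IsHomologyIso) ∧
    (∀ (M : OperadCollection.{u, v₁} k) (d : OperadDifferential (freeOperad M))
        (ν : DGOperadHom d dS)
        (M' : OperadCollection.{u, v₂} k) (d' : OperadDifferential (freeOperad M'))
        (ν' : DGOperadHom d' dS),
        FreeOperad.IsMinimal d → ν.IsHomologyIso →
        FreeOperad.IsMinimal d' → ν'.IsHomologyIso →
        Nonempty (DGOperadIso d d')) :=
  ⟨FreeOperad.exists_minimal_model, fun _ _ _ _ _ _ => FreeOperad.nonempty_dgOperadIso⟩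

theorem mainTheorem1 {k : Type u} [Field k] [CharZero k] (S : NonunitalOperad.{u, v} k)
    (dS : OperadDifferential S) (hS : ∀ p, Subsingleton (S.obj 1 p)) :
    (∃ (M : OperadCollection.{u, max u v} k) (d : OperadDifferential (freeOperad M))
        (ν : DGOperadHom d dS), FreeOperad.IsMinimal d ∧ ν.IsHomologyIso) ∧
    (∀ (M : OperadCollection.{u, w} k) (d : OperadDifferential (freeOperad M))
        (ν : DGOperadHom d dS)
        (M' : OperadCollection.{u, w} k) (d' : OperadDifferential (freeOperad M'))
        (ν' : DGOperadHom d' dS),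
        FreeOperad.IsMinimal d → ν.IsHomologyIso →
        FreeOperad.IsMinimal d' → ν'.IsHomologyIso →
        Nonempty (DGOperadIso d d')) :=
  (mainTheorem1_general S dS).imp_left fun h => h fun p => have := hS p; inferInstance
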